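/- Let $X'$ be a connected compact (Hausdorff) complex manifold, let $Z\subsetneq X'$ be a non-empty connected closed analytic subset, put $X:=X'\setminus Z$, and let $i\colon X\hookrightarrow X'$ and $j\colon Z\hookrightarrow X'$ be the inclusions. Write $\mathcal{O}_X$ for the sheaf of holomorphic functions on $X$, and $i^{-1}, j^{-1}$ for the topological inverse image functors. The manifold $X$ is called Hartogs if for every compact set $K\subset X$ such that $X\setminus K$ is connected, the restriction map $\Gamma(X,\mathcal{O}_X)\to\Gamma(X\setminus K,\mathcal{O}_X)$ is an isomorphism. Let $\mathcal{F}$ be a sheaf of $\mathbb{C}$-vector spaces on $X'$ (not necessarily coherent) such that $i^{-1}\mathcal{F}\cong\mathcal{O}_X$ as sheaves of $\mathbb{C}$-vector spaces and $\dim_{\mathbb{C}} H^1(X',\mathcal{F})=m<\infty$. Then the following assertions are equivalent: 1. $X$ is Hartogs; 2. the canonical homomorphism $\Gamma(X',\mathcal{F})\to\Gamma(Z,j^{-1}\mathcal{F})$ is surjective; 3. $\dim_{\mathbb{C}} H^1_c(X,\mathcal{O}_X)\le m$, where $H^1_c$ denotes cohomology with compact supports. -/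

import Mathlib

open CategoryTheory TopologicalSpace Opposite
open scoped Manifold ContDiff

noncomputable section

namespace HartogsLefschetz

section Holomorphic

variable (E : Type*) [NormedAddCommGroup E] [NormedSpace ℂ E]
variable (M : Type) [TopologicalSpace M] [ChartedSpace E M]

/-- The complex vector space of holomorphic functions on an open subset `U` of the complex
manifold `M`. -/
def holomorphicFunctions (U : Opens M) : Submodule ℂ (U → ℂ) where
  carrier := {f | MDifferentiable 𝓘(ℂ, E) 𝓘(ℂ, ℂ) f}
  add_mem' hf hg := MDifferentiable.add hf hg
  zero_mem' := mdifferentiable_const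
  smul_mem' c _ hf := MDifferentiable.const_smul c hf

variable {M} in
/-- Restriction of holomorphic functions from `V` to the smaller open set `U`. -/
def holomorphicRestrict {U V : Opens M} (h : U ≤ V) :
    holomorphicFunctions E M V →ₗ[ℂ] holomorphicFunctions E M U where
  toFun f := ⟨fun x => f.1 (Opens.inclusion h x),
    f.2.comp ((contMDiff_inclusion (n := 1) h).mdifferentiable one_ne_zero)⟩
  map_add' _ _ := rfl
  map_smul' _ _ := rfl

/-- The presheaf of holomorphic functions on `M`. -/
def holomorphicPresheaf : TopCat.Presheaf (ModuleCat.{0} ℂ) (TopCat.of M) where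
  obj U := ModuleCat.of ℂ (holomorphicFunctions E M U.unop)
  map i := ModuleCat.ofHom (holomorphicRestrict E i.unop.le)

/-- Holomorphy is a local property. -/
theorem mdifferentiable_of_locally {U : Opens M} (f : U → ℂ)
    (h : ∀ x : U, ∃ (V : Opens M) (hVU : V ≤ U), x.1 ∈ V ∧
      MDifferentiable 𝓘(ℂ, E) 𝓘(ℂ, ℂ) (fun y : V => f (Opens.inclusion hVU y))) :
    MDifferentiable 𝓘(ℂ, E) 𝓘(ℂ, ℂ) f := by
  intro x
  obtain ⟨V, hVU, hx, hV⟩ := h x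
  exact (differentiableWithinAt_localInvariantProp.liftPropAt_iff_comp_inclusion
    hVU f ⟨x.1, hx⟩).2 (hV ⟨x.1, hx⟩)

theorem holomorphicPresheaf_isSheaf : (holomorphicPresheaf E M).IsSheaf := by
  rw [TopCat.Presheaf.isSheaf_iff_isSheafUniqueGluing]
  intro ι U sf hsf
  have hcov (x : (iSup U : Opens M)) : ∃ i, x.1 ∈ U i := Opens.mem_iSup.1 x.2
  choose i hi using hcov
  let g (j : ι) : U j → ℂ := (sf j : holomorphicFunctions E M (U j)).1
  have hg (j k : ι) (x : M) (hj : x ∈ U j) (hk : x ∈ U k) : g j ⟨x, hj⟩ = g k ⟨x, hk⟩ :=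
    congrFun (congrArg Subtype.val (hsf j k)) ⟨x, hj, hk⟩
  refine ⟨(⟨fun x => g (i x) ⟨x.1, hi x⟩, mdifferentiable_of_locally E M _ fun x =>
    ⟨U (i x), le_iSup U (i x), hi x, ?_⟩⟩ : holomorphicFunctions E M (iSup U)), ?_, ?_⟩
  · convert! (sf (i x) : holomorphicFunctions E M (U (i x))).2 using 1
    funext y
    exact hg _ _ _ _ _
  · intro j
    exact Subtype.ext (funext fun y => hg _ _ _ _ _)
  · intro t ht
    exact Subtype.ext (funext fun x => congrFun (congrArg Subtype.val (ht (i x))) ⟨x.1, hi x⟩)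

/-- The sheaf `𝒪_M` of holomorphic functions on the complex manifold `M`, as a sheaf of complex
vector spaces. -/
def holomorphicSheaf : TopCat.Sheaf (ModuleCat.{0} ℂ) (TopCat.of M) :=
  ⟨holomorphicPresheaf E M, holomorphicPresheaf_isSheaf E M⟩

/-- `M` (a non-compact complex manifold) is Hartogs: for every compact `K ⊆ M` with connected
complement `U = M ∖ K`, the restriction map `Γ(M, 𝒪_M) → Γ(U, 𝒪_M)` is an isomorphism. -/
def IsHartogs : Prop :=
  ∀ U : Opens (TopCat.of M), IsCompact ((U : Set M)ᶜ) → _root_.IsConnected (U : Set M) →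
    Function.Bijective ((holomorphicSheaf E M).presheaf.map (homOfLE (le_top : U ≤ ⊤)).op)

variable {M} in
/-- `Z` is an analytic subset of `M`: every point of `M` has an open neighbourhood in which `Z` is
the set of common zeros of finitely many holomorphic functions. -/
def IsAnalyticSubset (Z : Set M) : Prop :=
  ∀ x : M, ∃ U : Opens M, x ∈ U ∧ ∃ (k : ℕ) (f : Fin k → holomorphicFunctions E M U),
    ∀ y : U, (y : M) ∈ Z ↔ ∀ i, (f i).1 y = 0

end Holomorphic

section Cohomology

variable (X : TopCat.{0})

/-- The functor of global sections `Γ(X, -)` on sheaves of complex vector spaces. -/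
def globalSections : TopCat.Sheaf (ModuleCat.{0} ℂ) X ⥤ ModuleCat.{0} ℂ :=
  TopCat.Sheaf.forget (ModuleCat.{0} ℂ) X ⋙ (evaluation _ _).obj (op ⊤)

instance : (globalSections X).Additive where
  map_add := rfl

variable {X} in
/-- The subspace `Γ_c(X, F)` of global sections of `F` with compact support, that is, vanishing
on the complement of a compact closed set. -/
def compactlySupported (F : TopCat.Sheaf (ModuleCat.{0} ℂ) X) :
    Submodule ℂ (F.presheaf.obj (op ⊤)) where
  carrier := {s | ∃ U : Opens X, IsCompact ((U : Set X)ᶜ) ∧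
    F.presheaf.map (homOfLE (le_top : U ≤ ⊤)).op s = 0}
  add_mem' := by
    rintro s t ⟨U, hU, hs⟩ ⟨V, hV, ht⟩
    refine ⟨U ⊓ V, ?_, ?_⟩
    · rw [Opens.coe_inf, Set.compl_inter]
      exact hU.union hV
    · have hs' : F.presheaf.map (homOfLE (le_top : U ⊓ V ≤ ⊤)).op s = 0 := by
        rw [show (homOfLE (le_top : U ⊓ V ≤ ⊤)).op =
          (homOfLE (le_top : U ≤ ⊤)).op ≫ (homOfLE (inf_le_left : U ⊓ V ≤ U)).op from rfl,
          F.presheaf.map_comp, ConcreteCategory.comp_apply, hs, map_zero]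
      have ht' : F.presheaf.map (homOfLE (le_top : U ⊓ V ≤ ⊤)).op t = 0 := by
        rw [show (homOfLE (le_top : U ⊓ V ≤ ⊤)).op =
          (homOfLE (le_top : V ≤ ⊤)).op ≫ (homOfLE (inf_le_right : U ⊓ V ≤ V)).op from rfl,
          F.presheaf.map_comp, ConcreteCategory.comp_apply, ht, map_zero]
      rw [map_add, hs', ht', add_zero]
  zero_mem' := ⟨⊤, by simp, map_zero _⟩
  smul_mem' := by
    rintro c s ⟨U, hU, hs⟩
    exact ⟨U, hU, by rw [map_smul, hs, smul_zero]⟩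

/-- The functor of global sections with compact support `Γ_c(X, -)`. -/
def compactSections : TopCat.Sheaf (ModuleCat.{0} ℂ) X ⥤ ModuleCat.{0} ℂ where
  obj F := ModuleCat.of ℂ (compactlySupported F)
  map {F G} φ := ModuleCat.ofHom ((φ.hom.app (op ⊤)).hom.restrict (by
    rintro s ⟨U, hU, hs⟩
    refine ⟨U, hU, ?_⟩
    have h := NatTrans.naturality_apply φ.hom (homOfLE (le_top : U ≤ ⊤)).op s
    exact h.symm.trans ((congrArg _ hs).trans (map_zero _))))
  map_id _ := rfl
  map_comp _ _ := rfl

instance : (compactSections X).Additive where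
  map_add := rfl

variable {X}

/-- Sheaf cohomology `H^n(X, F)`, as a complex vector space: the right derived functors of
`Γ(X, -)`. -/
def cohomology (n : ℕ) (F : TopCat.Sheaf (ModuleCat.{0} ℂ) X) : ModuleCat.{0} ℂ :=
  ((globalSections X).rightDerived n).obj F

/-- Cohomology with compact support `H^n_c(X, F)`, as a complex vector space: the right derived
functors of `Γ_c(X, -)`. -/
def compactCohomology (n : ℕ) (F : TopCat.Sheaf (ModuleCat.{0} ℂ) X) : ModuleCat.{0} ℂ :=
  ((compactSections X).rightDerived n).obj F

/-- The inclusion into `X` of a subset `S` (for instance an open or a closed one), which carries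
the subspace topology. -/
def inclusionMap {X A : Type} [TopologicalSpace X] [SetLike A X] (S : A) :
    TopCat.of S ⟶ TopCat.of X :=
  TopCat.ofHom ⟨Subtype.val, continuous_subtype_val⟩

/-- The topological inverse image `f⁻¹F` of a sheaf of complex vector spaces. -/
abbrev inverseImage {X Y : TopCat.{0}} (f : X ⟶ Y) (F : TopCat.Sheaf (ModuleCat.{0} ℂ) Y) :
    TopCat.Sheaf (ModuleCat.{0} ℂ) X :=
  (TopCat.Sheaf.pullback (ModuleCat.{0} ℂ) f).obj F

/-- The canonical map `Γ(Y, F) → Γ(X, f⁻¹F)`, given on global sections by the unit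
`F → f_* f⁻¹F` of the adjunction. -/
def sectionsPullback {X Y : TopCat.{0}} (f : X ⟶ Y) (F : TopCat.Sheaf (ModuleCat.{0} ℂ) Y) :
    (globalSections Y).obj F ⟶ (globalSections X).obj (inverseImage f F) :=
  (globalSections Y).map
    ((TopCat.Sheaf.pullbackPushforwardAdjunction (ModuleCat.{0} ℂ) f).unit.app F)

end Cohomology

end HartogsLefschetz

end

/-!
Let `i : X → X'` and `j : Z → X'` be the inclusions. The three conditions are proved equivalent by
going around a cycle.

*Hartogs implies surjectivity.* A section of `j⁻¹ F` on `Z` extends to a section of `F` on a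
neighbourhood of `Z` (`exists_section_near_closed`), which may be taken connected, say `U`. The
proper analytic subset `Z` does not disconnect `U` (`isConnected_diff_of_isAnalyticSubset`), so
that `U ∖ Z` is a connected complement in `X` of a compact set. Through the isomorphism
`i⁻¹ F ≅ 𝒪_X` the section on `U ∖ Z` is a holomorphic function; by the Hartogs property it extends to `X`,
and glueing gives a global section of `F`.

*Surjectivity implies the bound.* Let `I` be an injective resolution of `F`; its restriction to
`X` is one of `i⁻¹ F`, and compactly supported sections of `i⁻¹ I` are the sections of `I`
vanishing near `Z`. If such a cocycle is the differential of a global section `t`, then `t` comes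
from `F` near `Z`, and subtracting a global section of `F` makes `t` vanish near `Z`. Hence
`H¹_c(X, i⁻¹ F)` embeds into `H¹(X', F)` (`rank_compactCohomology_le`).

*Finite dimension implies Hartogs.* Only the finiteness of `H¹_c(X, 𝒪_X)` matters
(`isHartogs_of_finite`). Let `U` be the connected complement of a compact set. The connecting map
from `𝒪(U)` to `H¹_c(X, 𝒪_X)` is linear, and its kernel consists of functions that extend to `X`
(`exists_lift_to_compactCohomology` and the identity theorem; `X` is not compact). So restrictions
of global functions have finite codimension in `𝒪(U)`. For `f` in `𝒪(U)`, linear algebra applied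
to the polynomials in `f` and to the multiples of `f` by global functions gives a nonconstant
polynomial `P` such that `P(f)` extends to `X`, and a global `h ≠ 0` such that `h f` extends to a
global `g`, unless `f` is algebraic over `ℂ` and therefore constant
(`polynomial_and_quotient_of_finite_quotient`). By the identity theorem `P(g / h)` extends to a
holomorphic function on all of `X`, hence `g / h` is locally bounded, and Riemann's extension theorem, in the form of
the division theorem `exists_div_of_bounded`, shows that `g / h` is a holomorphic function on `X`
extending `f` (`exists_extension_of_finite`).
-/

noncomputable section

namespace HartogsLefschetz

/-! ### Sections of sheaves and of their inverse images -/

section Restriction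
variable {X : TopCat.{0}}

/-- Restriction of sections from `V` to `U ≤ V`, as a linear map. -/
def res (P : TopCat.Presheaf (ModuleCat.{0} ℂ) X) {U V : Opens X} (h : U ≤ V) :
    P.obj (op V) →ₗ[ℂ] P.obj (op U) :=
  (P.map (homOfLE h).op).hom

/-- The map on sections over `U` induced by a morphism of presheaves, as a linear map. -/
def onSections {P Q : TopCat.Presheaf (ModuleCat.{0} ℂ) X} (φ : P ⟶ Q) (U : Opens X) :
    P.obj (op U) →ₗ[ℂ] Q.obj (op U) :=
  (φ.app (op U)).hom

theorem res_res (P : TopCat.Presheaf (ModuleCat.{0} ℂ) X) {U V W : Opens X} (h : U ≤ V)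
    (h' : V ≤ W) (s : P.obj (op W)) : res P h (res P h' s) = res P (h.trans h') s := by
  have := congrArg (fun φ => φ.hom s) (P.map_comp (homOfLE h').op (homOfLE h).op)
  exact this.symm

@[simp]
theorem res_self (P : TopCat.Presheaf (ModuleCat.{0} ℂ) X) {U : Opens X} (h : U ≤ U)
    (s : P.obj (op U)) : res P h s = s :=
  congrArg (fun φ => φ.hom s) (P.map_id (op U))

theorem onSections_res {P Q : TopCat.Presheaf (ModuleCat.{0} ℂ) X} (φ : P ⟶ Q) {U V : Opens X}
    (h : U ≤ V) (s : P.obj (op V)) :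
    onSections φ U (res P h s) = res Q h (onSections φ V s) :=
  congrArg (fun ψ => ψ.hom s) (φ.naturality (homOfLE h).op)

theorem onSections_comp {P Q R : TopCat.Presheaf (ModuleCat.{0} ℂ) X} (φ : P ⟶ Q) (ψ : Q ⟶ R)
    (U : Opens X) (s : P.obj (op U)) :
    onSections (φ ≫ ψ) U s = onSections ψ U (onSections φ U s) := rfl

theorem eq_of_locally_eq (F : TopCat.Sheaf (ModuleCat.{0} ℂ) X) {V : Opens X}
    {s t : F.presheaf.obj (op V)}
    (h : ∀ x ∈ V, ∃ (U : Opens X) (hU : U ≤ V), x ∈ U ∧ res F.presheaf hU s = res F.presheaf hU t) :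
    s = t := by
  choose U hU hxU hst using h
  refine F.eq_of_locally_eq' (fun x : V => U x x.2) V (fun x => homOfLE (hU x x.2)) ?_ s t
    fun x => hst x x.2
  exact fun x hx => Opens.mem_iSup.2 ⟨⟨x, hx⟩, hxU x hx⟩

theorem exists_gluing (F : TopCat.Sheaf (ModuleCat.{0} ℂ) X) {ι : Type*} (U : ι → Opens X)
    (V : Opens X) (hU : ∀ i, U i ≤ V) (hV : V ≤ iSup U) (s : ∀ i, F.presheaf.obj (op (U i)))
    (h : ∀ i j, res F.presheaf (inf_le_left : U i ⊓ U j ≤ U i) (s i) =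
      res F.presheaf (inf_le_right : U i ⊓ U j ≤ U j) (s j)) :
    ∃ t : F.presheaf.obj (op V), ∀ i, res F.presheaf (hU i) t = s i :=
  (F.existsUnique_gluing' U V (fun i => homOfLE (hU i)) hV s h).exists

theorem exists_res_eq_of_germ_eq (P : TopCat.Presheaf (ModuleCat.{0} ℂ) X) {U V : Opens X} {x : X}
    (hU : x ∈ U) (hV : x ∈ V) (s : P.obj (op U)) (t : P.obj (op V))
    (h : (P.germ U x hU).hom s = (P.germ V x hV).hom t) :
    ∃ (W : Opens X) (hWU : W ≤ U) (hWV : W ≤ V), x ∈ W ∧ res P hWU s = res P hWV t := by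
  obtain ⟨W, hx, i, j, e⟩ := P.germ_eq x hU hV s t h
  exact ⟨W, i.le, j.le, hx, e⟩

end Restriction

section InverseImage
variable {X Y : TopCat.{0}} (f : X ⟶ Y) (F : TopCat.Sheaf (ModuleCat.{0} ℂ) Y)

/-- The canonical map `F → f_* f⁻¹ F`. -/
abbrev pullbackUnit : F ⟶ (TopCat.Sheaf.pushforward (ModuleCat.{0} ℂ) f).obj (inverseImage f F) :=
  (TopCat.Sheaf.pullbackPushforwardAdjunction (ModuleCat.{0} ℂ) f).unit.app F

/-- The canonical map from `F` to the pushforward of its inverse image as a presheaf. -/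
abbrev presheafUnit : F.obj ⟶ (TopCat.Presheaf.pushforward (ModuleCat.{0} ℂ) f).obj
    ((TopCat.Presheaf.pullback (ModuleCat.{0} ℂ) f).obj F.obj) :=
  (TopCat.Presheaf.pullbackPushforwardAdjunction (ModuleCat.{0} ℂ) f).unit.app F.obj

/-- The inverse image of `F` as a presheaf. -/
abbrev presheafPullback : TopCat.Presheaf (ModuleCat.{0} ℂ) X :=
  (TopCat.Presheaf.pullback (ModuleCat.{0} ℂ) f).obj F.obj

/-- The unit of the adjunction between pushforward and the inverse image constructed by sheafifying
the presheaf inverse image. -/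
theorem sheafAdjunction_unit_eq :
    ((Functor.sheafPullbackConstruction.sheafAdjunctionContinuous (Opens.map f)
      (ModuleCat.{0} ℂ) (Opens.grothendieckTopology Y) (Opens.grothendieckTopology X)).unit.app
        F).hom = presheafUnit f F ≫ (TopCat.Presheaf.pushforward (ModuleCat.{0} ℂ) f).map
      (toSheafify (Opens.grothendieckTopology X) (presheafPullback f F)) := by
  refine (Adjunction.map_restrictFullyFaithful_unit_app
    (((Opens.map f).op.lanAdjunction (ModuleCat.{0} ℂ)).comp
      (sheafificationAdjunction (Opens.grothendieckTopology X) (ModuleCat.{0} ℂ)))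
    (fullyFaithfulSheafToPresheaf (Opens.grothendieckTopology Y) (ModuleCat.{0} ℂ))
    (Functor.FullyFaithful.id (TopCat.Sheaf (ModuleCat.{0} ℂ) X))
    (L := Functor.sheafPullbackConstruction.sheafPullback (Opens.map f)
      (ModuleCat.{0} ℂ) (Opens.grothendieckTopology Y) (Opens.grothendieckTopology X))
    (R := (Opens.map f).sheafPushforwardContinuous _ _ _)
    (Iso.refl _) (Iso.refl _) F).trans ?_
  rw [Adjunction.comp_unit_app]
  ext V a
  rfl

/-- The sheaf inverse image is the sheafification of the presheaf inverse image, compatibly with the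
canonical maps from `F`. -/
theorem exists_iso_pullbackUnit_eq :
    ∃ e : sheafify (Opens.grothendieckTopology X) (presheafPullback f F) ≅ (inverseImage f F).obj,
      ∀ V : Opens Y, (pullbackUnit f F).hom.app (op V) =
        (presheafUnit f F).app (op V) ≫
        (toSheafify (Opens.grothendieckTopology X) (presheafPullback f F)).app
            (op ((Opens.map f).obj V)) ≫ e.hom.app (op ((Opens.map f).obj V)) := by
  let adj₁ := TopCat.Sheaf.pullbackPushforwardAdjunction (ModuleCat.{0} ℂ) f
  let adj₂ := Functor.sheafPullbackConstruction.sheafAdjunctionContinuous (Opens.map f)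
    (ModuleCat.{0} ℂ) (Opens.grothendieckTopology Y) (Opens.grothendieckTopology X)
  have h := Adjunction.unit_leftAdjointUniq_hom_app adj₂ adj₁ F
  refine ⟨(sheafToPresheaf _ _).mapIso ((adj₂.leftAdjointUniq adj₁).app F), fun V => ?_⟩
  have h' := congrArg (fun φ => φ.hom.app (op V)) h
  refine h'.symm.trans ?_
  have key := congrArg (fun φ => φ.app (op V)) (sheafAdjunction_unit_eq f F)
  exact (congrArg (fun φ => φ ≫ ((adj₂.leftAdjointUniq adj₁).hom.app F).hom.app
    (op ((Opens.map f).obj V))) key).trans (Category.assoc _ _ _)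

/-- The canonical map `F(V) → (f⁻¹ F)(f⁻¹ V)`. -/
def unitOn (V : Opens Y) : F.presheaf.obj (op V) →ₗ[ℂ]
    (inverseImage f F).presheaf.obj (op ((Opens.map f).obj V)) :=
  ((pullbackUnit f F).hom.app (op V)).hom

theorem map_le {U V : Opens Y} (h : U ≤ V) : (Opens.map f).obj U ≤ (Opens.map f).obj V :=
  fun _ hx => h hx

theorem unitOn_res {U V : Opens Y} (h : U ≤ V) (s : F.presheaf.obj (op V)) :
    unitOn f F U (res F.presheaf h s) =
      res (inverseImage f F).presheaf (map_le f h) (unitOn f F V s) :=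
  congrArg (fun ψ => ψ.hom s) ((pullbackUnit f F).hom.naturality (homOfLE h).op)

theorem onSections_unitOn {F G : TopCat.Sheaf (ModuleCat.{0} ℂ) Y} (φ : F ⟶ G) (V : Opens Y)
    (s : F.presheaf.obj (op V)) :
    unitOn f G V (onSections φ.hom V s) =
      onSections ((TopCat.Sheaf.pullback (ModuleCat.{0} ℂ) f).map φ).hom _ (unitOn f F V s) :=
  congrArg (fun ψ => (ψ.hom.app (op V)).hom s)
    ((TopCat.Sheaf.pullbackPushforwardAdjunction (ModuleCat.{0} ℂ) f).unit.naturality φ)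

/-- A section of `F` that dies in `f⁻¹ F` vanishes near every point of the image of `f`. -/
theorem exists_res_eq_zero_of_pullbackUnit_eq_zero {V : Opens Y} (a : F.presheaf.obj (op V))
    (ha : unitOn f F V a = 0) (x : X) (hx : f x ∈ V) :
    ∃ (W : Opens Y) (hW : W ≤ V), f x ∈ W ∧ res F.presheaf hW a = 0 := by
  obtain ⟨e, he⟩ := exists_iso_pullbackUnit_eq f F
  let P := presheafPullback f F
  let τ : P ⟶ sheafify (Opens.grothendieckTopology X) P := toSheafify _ P
  let p : P.obj (op ((Opens.map f).obj V)) := onSections (presheafUnit f F) V a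
  have h1 : onSections e.hom _ (onSections τ _ p) = 0 := by
    have := congrArg (fun φ => φ.hom a) (he V)
    exact this.symm.trans ha
  have h2 : onSections τ _ p = onSections τ _ 0 := by
    have h3 := congrArg (onSections e.inv ((Opens.map f).obj V)) h1
    rw [← onSections_comp, e.hom_inv_id] at h3
    rw [map_zero]; rw [map_zero] at h3; exact h3
  obtain ⟨U, i, hi, hxU⟩ :=
    Presheaf.equalizerSieve_mem (Opens.grothendieckTopology X) τ p 0 h2 x hx
  have hg : (P.germ _ x hx).hom p = 0 := by
    have h4 := TopCat.Presheaf.germ_res_apply P i x hxU p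
    have h5 : (P.map i.op).hom p = (P.map i.op).hom 0 := hi
    rw [map_zero] at h5
    refine h4.symm.trans ((congrArg (P.germ U x hxU).hom h5).trans (map_zero _))
  have hg' : (F.presheaf.germ V (f x) hx).hom a = 0 := by
    have h6 := congrArg (fun φ => φ.hom a)
      (TopCat.Presheaf.germ_stalkPullbackHom (ModuleCat.{0} ℂ) f F.presheaf x V hx)
    have h7 : (TopCat.Presheaf.stalkPullbackHom (ModuleCat.{0} ℂ) f F.presheaf x).hom
      ((F.presheaf.germ V (f x) hx).hom a) = 0 := h6.trans hg
    have h8 := congrArg (fun φ => φ.hom ((F.presheaf.germ V (f x) hx).hom a))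
      (TopCat.Presheaf.stalkPullbackIso (ModuleCat.{0} ℂ) f F.presheaf x).hom_inv_id
    refine h8.symm.trans ?_
    exact (congrArg
      (TopCat.Presheaf.stalkPullbackInv (ModuleCat.{0} ℂ) f F.presheaf x).hom h7).trans (map_zero _)
  obtain ⟨W, h, _, hxW, hz⟩ := exists_res_eq_of_germ_eq F.presheaf hx hx a 0
    (hg'.trans (map_zero _).symm)
  exact ⟨W, h, hxW, hz.trans (map_zero _)⟩

/-- Sections of `f⁻¹ F` are locally images of sections of `F`. -/
theorem exists_pullbackUnit_eq_locally {U : Opens X}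
    (b : (inverseImage f F).presheaf.obj (op U)) (x : X) (hx : x ∈ U) :
    ∃ (V : Opens Y) (W : Opens X) (hWU : W ≤ U) (hWV : W ≤ (Opens.map f).obj V)
      (a : F.presheaf.obj (op V)), x ∈ W ∧
      res (inverseImage f F).presheaf hWV (unitOn f F V a) =
        res (inverseImage f F).presheaf hWU b := by
  obtain ⟨e, he⟩ := exists_iso_pullbackUnit_eq f F
  let P := presheafPullback f F
  let τ : P ⟶ sheafify (Opens.grothendieckTopology X) P := toSheafify _ P
  obtain ⟨U', i, ⟨p, hp⟩, hxU'⟩ := Presheaf.imageSieve_mem (Opens.grothendieckTopology X) τ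
    (U := op U) (onSections e.inv _ b) x hx
  obtain ⟨V, hxV, a, ha⟩ := TopCat.Presheaf.exists_germ_eq F.presheaf
    ((TopCat.Presheaf.stalkPullbackInv (ModuleCat.{0} ℂ) f F.presheaf x).hom
      ((P.germ U' x hxU').hom p))
  have hg : (P.germ _ x hxV).hom (onSections (presheafUnit f F) V a) =
      (P.germ U' x hxU').hom p := by
    have h6 := congrArg (fun φ => φ.hom a)
      (TopCat.Presheaf.germ_stalkPullbackHom (ModuleCat.{0} ℂ) f F.presheaf x V hxV)
    have h8 := congrArg (fun φ => φ.hom ((P.germ U' x hxU').hom p))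
      (TopCat.Presheaf.stalkPullbackIso (ModuleCat.{0} ℂ) f F.presheaf x).inv_hom_id
    refine h6.symm.trans (Eq.trans ?_ h8)
    exact congrArg (TopCat.Presheaf.stalkPullbackHom (ModuleCat.{0} ℂ) f F.presheaf x).hom ha
  obtain ⟨W, hW1, hW2, hxW, hW⟩ := exists_res_eq_of_germ_eq P _ _ _ _ hg
  refine ⟨V, W, hW2.trans i.le, hW1, a, hxW, ?_⟩
  have h1 : unitOn f F V a =
      onSections e.hom _ (onSections τ _ (onSections (presheafUnit f F) V a)) :=
    congrArg (fun φ => φ.hom a) (he V)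
  have h2 : onSections τ _ p = res _ i.le (onSections e.inv _ b) := hp
  have h3 : onSections e.hom _ (onSections e.inv _ b) = b :=
    congrArg (fun φ => (φ.app (op U)).hom b) e.inv_hom_id
  have h4 : res (inverseImage f F).presheaf hW1 (unitOn f F V a) =
      onSections e.hom _ (onSections τ _ (res P hW1 (onSections (presheafUnit f F) V a))) := by
    rw [onSections_res τ, onSections_res e.hom, ← h1]
  refine h4.trans ?_
  rw [hW, onSections_res τ, h2, res_res, onSections_res e.hom, h3]

end InverseImage

/-! ### Inverse images on open and on closed subsets -/

section OpenSubset
variable {Y : Type} [TopologicalSpace Y] (X : Opens Y)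
  (F : TopCat.Sheaf (ModuleCat.{0} ℂ) (TopCat.of Y))

theorem unitOn_injective_of_le {V : Opens (TopCat.of Y)} (hV : V ≤ X) :
    Function.Injective (unitOn (inclusionMap X) F V) := by
  refine (injective_iff_map_eq_zero _).2 fun a ha => eq_of_locally_eq F fun x hx => ?_
  obtain ⟨W, hW, hxW, h⟩ := exists_res_eq_zero_of_pullbackUnit_eq_zero (inclusionMap X) F a ha
    ⟨x, hV hx⟩ hx
  exact ⟨W, hW, hxW, h.trans (map_zero _).symm⟩

/-- The image in `Y` of an open subset of the open subset `X`. -/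
def imageOpens (W : Opens X) : Opens Y :=
  ⟨Subtype.val '' (W : Set X), X.2.isOpenMap_subtype_val _ W.2⟩

theorem imageOpens_le (W : Opens X) : imageOpens X W ≤ X := by
  rintro _ ⟨y, _, rfl⟩; exact y.2

theorem map_imageOpens (W : Opens X) :
    (Opens.map (inclusionMap X)).obj (imageOpens X W) = W := by
  ext y
  constructor
  · rintro ⟨z, hz, h⟩
    rwa [← Subtype.ext h]
  · exact fun h => ⟨y, h, rfl⟩

/-- The inverse image on the open subset `X` is the restriction of the sheaf: over open subsets of
`X`, the canonical map is bijective. -/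
theorem unitOn_bijective_of_le {V : Opens (TopCat.of Y)} (hV : V ≤ X) :
    Function.Bijective (unitOn (inclusionMap X) F V) := by
  refine ⟨unitOn_injective_of_le X F hV, ?_⟩
  refine TopCat.Presheaf.app_surjective_of_injective_of_locally_surjective
    (pullbackUnit (inclusionMap X) F) V ?_ ?_
  · intro x hx
    refine (injective_iff_map_eq_zero _).2 fun g hg => ?_
    obtain ⟨W, hW, a, rfl⟩ := TopCat.Presheaf.exists_germ_eq F.presheaf g
    have h1 := (TopCat.Presheaf.stalkFunctor_map_germ_apply W x hW
      (pullbackUnit (inclusionMap X) F).hom a).symm.trans hg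
    obtain ⟨W', hW', _, hxW', h⟩ := exists_res_eq_of_germ_eq _ hW hW _ 0
      (h1.trans (map_zero _).symm)
    rw [map_zero] at h
    replace h := (unitOn_res (inclusionMap X) F hW' a).trans h
    obtain ⟨W'', hW'', hx'', h''⟩ := exists_res_eq_zero_of_pullbackUnit_eq_zero (inclusionMap X) F
      _ h ⟨x, hV hx⟩ hxW'
    rw [res_res] at h''
    have h3 := TopCat.Presheaf.germ_res_apply F.presheaf (homOfLE (hW''.trans hW')) x hx'' a
    exact h3.symm.trans ((congrArg (F.presheaf.germ W'' x hx'').hom h'').trans (map_zero _))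
  · intro t x hx
    obtain ⟨V', W, hWU, hWV, a, hxW, h⟩ := exists_pullbackUnit_eq_locally (inclusionMap X) F t
      ⟨x, hV hx⟩ hx
    have hle : imageOpens X W ≤ V := by
      rintro _ ⟨y, hy, rfl⟩; exact hWU hy
    have hle' : imageOpens X W ≤ V' := by
      rintro _ ⟨y, hy, rfl⟩; exact hWV hy
    refine ⟨imageOpens X W, ⟨⟨x, hV hx⟩, hxW, rfl⟩, homOfLE hle, res F.presheaf hle' a, ?_⟩
    have hW : (Opens.map (inclusionMap X)).obj (imageOpens X W) ≤ W := (map_imageOpens X W).le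
    have h4 := congrArg (res (inverseImage (inclusionMap X) F).presheaf hW) h
    refine (unitOn_res (inclusionMap X) F hle' a).trans ?_
    exact (res_res _ _ _ _).symm.trans
      (h4.trans (res_res (inverseImage (inclusionMap X) F).presheaf _ _ t))

end OpenSubset

section ClosedSubset
variable {Y : Type} [TopologicalSpace Y] (Z : Closeds Y)
  (F : TopCat.Sheaf (ModuleCat.{0} ℂ) (TopCat.of Y))

theorem top_le_map_inclusionMap {V : Opens Y} (h : (Z : Set Y) ⊆ V) :
    (⊤ : Opens Z) ≤ (Opens.map (inclusionMap Z)).obj V := fun x _ => h x.2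

/-- Two sections of `F` near `Z` with the same image in `j⁻¹ F` agree near `Z`. -/
theorem exists_res_eq_zero_near_closed {V : Opens Y} (hV : (Z : Set Y) ⊆ V)
    (a : F.presheaf.obj (op V)) (ha : unitOn (inclusionMap Z) F V a = 0) :
    ∃ (W : Opens Y) (hW : W ≤ V), (Z : Set Y) ⊆ W ∧ res F.presheaf hW a = 0 := by
  have h (z : Z) := exists_res_eq_zero_of_pullbackUnit_eq_zero (inclusionMap Z) F a ha z (hV z.2)
  choose W hW hzW h0 using h
  refine ⟨iSup W, iSup_le hW, fun z hz => Opens.mem_iSup.2 ⟨⟨z, hz⟩, hzW ⟨z, hz⟩⟩, ?_⟩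
  refine eq_of_locally_eq F fun x hx => ?_
  obtain ⟨z, hz⟩ := Opens.mem_iSup.1 hx
  exact ⟨W z, le_iSup W z, hz, by rw [res_res, h0, map_zero]⟩

/-- Every section of `j⁻¹ F` over the closed subset `Z` of a compact Hausdorff space extends to
a section of `F` on a neighbourhood of `Z`. -/
theorem exists_section_near_closed [T2Space Y] [CompactSpace Y]
    (b : (inverseImage (inclusionMap Z) F).presheaf.obj (op ⊤)) :
    ∃ V : Opens Y, (Z : Set Y) ⊆ V ∧ ∃ a : F.presheaf.obj (op V),
      unitOn (inclusionMap Z) F V a =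
        res (inverseImage (inclusionMap Z) F).presheaf le_top b := by
  have hloc (z : Z) : ∃ (V : Opens Y) (a : F.presheaf.obj (op V)), z.1 ∈ V ∧
      unitOn (inclusionMap Z) F V a =
        res (inverseImage (inclusionMap Z) F).presheaf le_top b := by
    obtain ⟨V, W, hWU, hWV, a, hzW, h⟩ :=
      exists_pullbackUnit_eq_locally (inclusionMap Z) F b z trivial
    obtain ⟨O, hO, hOW⟩ := isOpen_induced_iff.1 W.2
    have hle : V ⊓ ⟨O, hO⟩ ≤ V := inf_le_left
    have hle' : (Opens.map (inclusionMap Z)).obj (V ⊓ ⟨O, hO⟩) ≤ W := by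
      intro y hy
      have : y ∈ Subtype.val ⁻¹' O := hy.2
      rwa [hOW] at this
    refine ⟨V ⊓ ⟨O, hO⟩, res F.presheaf hle a, ⟨hWV hzW, ?_⟩, ?_⟩
    · have : z ∈ (W : Set Z) := hzW
      change z ∈ W.carrier at this
      rwa [← hOW] at this
    · rw [unitOn_res]
      have h4 := congrArg (res (inverseImage (inclusionMap Z) F).presheaf hle') h
      rw [res_res, res_res] at h4
      exact h4
  choose V a hzV ha using hloc
  have hZc : IsCompact (Z : Set Y) := Z.isClosed.isCompact
  obtain ⟨t, ht⟩ := hZc.elim_finite_subcover (fun z : Z => (V z : Set Y)) (fun z => (V z).2)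
    fun z hz => Set.mem_iUnion.2 ⟨⟨z, hz⟩, hzV ⟨z, hz⟩⟩
  obtain ⟨v, hZv, hv, hvV⟩ := exists_subset_iUnion_closure_subset Z.isClosed
    (u := fun z : t => (V z : Set Y)) (fun z => (V z).2) (fun _ _ => Set.toFinite _)
    (by simpa [Set.iUnion_subtype] using ht)
  -- `A i j` is the largest open set on which the local sections number `i` and `j` agree.
  let A (i j : t) : Opens Y := sSup {O | ∃ (h : O ≤ V i) (h' : O ≤ V j),
    res F.presheaf h (a i) = res F.presheaf h' (a j)}
  let W : Opens Y := ⟨(⋃ i, v i) ∩ ⋂ i, ⋂ j, ((closure (v i) ∩ closure (v j))ᶜ ∪ A i j), by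
    refine (isOpen_iUnion hv).inter (isOpen_iInter_of_finite fun i => isOpen_iInter_of_finite
      fun j => IsOpen.union ?_ (A i j).2)
    exact (isClosed_closure.inter isClosed_closure).isOpen_compl⟩
  have hZW : (Z : Set Y) ⊆ W := by
    refine fun z hz => ⟨hZv hz, Set.mem_iInter.2 fun i => Set.mem_iInter.2 fun j => ?_⟩
    by_cases hc : z ∈ closure (v i) ∩ closure (v j)
    swap
    · exact Or.inl hc
    right
    have hi : z ∈ V i := hvV i hc.1
    have hj : z ∈ V j := hvV j hc.2
    have h0 : unitOn (inclusionMap Z) F (V i ⊓ V j)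
        (res F.presheaf inf_le_left (a i) - res F.presheaf inf_le_right (a j)) = 0 := by
      rw [map_sub, unitOn_res, unitOn_res, ha, ha]
      exact sub_eq_zero.2 ((res_res _ _ _ _).trans (res_res _ _ _ _).symm)
    obtain ⟨O, hO, hzO, h⟩ := exists_res_eq_zero_of_pullbackUnit_eq_zero (inclusionMap Z) F _ h0
      ⟨z, hz⟩ ⟨hi, hj⟩
    rw [map_sub, sub_eq_zero, res_res, res_res] at h
    exact Opens.mem_sSup.2 ⟨O, ⟨_, _, h⟩, hzO⟩
  let U (i : t) : Opens Y := ⟨v i, hv i⟩ ⊓ W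
  have hUV (i : t) : U i ≤ V i := fun x hx => hvV i (subset_closure hx.1)
  have hcov : W ≤ iSup U := by
    intro x hx
    obtain ⟨i, hi⟩ := Set.mem_iUnion.1 hx.1
    exact Opens.mem_iSup.2 ⟨i, hi, hx⟩
  obtain ⟨s, hs⟩ := exists_gluing F U W (fun i => inf_le_right) hcov
    (fun i => res F.presheaf (hUV i) (a i)) (by
      intro i j
      refine eq_of_locally_eq F fun x hx => ?_
      have hx' : x ∈ A i j := by
        refine (Set.mem_iInter.1 (Set.mem_iInter.1 hx.1.2.2 i) j).resolve_left ?_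
        exact not_not.2 ⟨subset_closure hx.1.1, subset_closure hx.2.1⟩
      obtain ⟨O, ⟨h, h', hO⟩, hxO⟩ := Opens.mem_sSup.1 hx'
      refine ⟨O ⊓ (U i ⊓ U j), inf_le_right, ⟨hxO, hx⟩, ?_⟩
      have h5 := congrArg (res F.presheaf (inf_le_left : O ⊓ (U i ⊓ U j) ≤ O)) hO
      have h6 := ((res_res _ _ _ _).symm.trans h5).trans (res_res _ _ _ _)
      refine (congrArg _ (res_res _ _ _ _)).trans (Eq.trans ?_ (congrArg _ (res_res _ _ _ _)).symm)
      exact (res_res _ _ _ _).trans (h6.trans (res_res _ _ _ _).symm))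
  refine ⟨W, hZW, s, ?_⟩
  refine eq_of_locally_eq (inverseImage (inclusionMap Z) F) fun z hz => ?_
  obtain ⟨i, hi⟩ := Opens.mem_iSup.1 (hcov hz)
  refine ⟨(Opens.map (inclusionMap Z)).obj (U i), fun y hy => hy.2, hi, ?_⟩
  have h6 := congrArg (unitOn (inclusionMap Z) F (U i)) (hs i)
  rw [unitOn_res, unitOn_res, ha] at h6
  refine h6.trans ?_
  exact (res_res _ _ _ _).trans (res_res _ _ _ _).symm

end ClosedSubset

/-! ### Injective sheaves: restriction to open subsets, flasqueness -/

section ExtensionByZero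
variable {Y : Type} [TopologicalSpace Y] (X : Opens Y)

/-- The extension by zero, as a presheaf on `Y`, of a presheaf `A` on the open subset `X`: its
sections over `W` are those of `A` if `W ⊆ X`, and `0` otherwise. -/
def extendZero (A : TopCat.Presheaf (ModuleCat.{0} ℂ) (TopCat.of X)) :
    TopCat.Presheaf (ModuleCat.{0} ℂ) (TopCat.of Y) where
  obj W := ModuleCat.of ℂ
    ({ carrier := {s | W.unop ≤ X ∨ s = 0}
       add_mem' := by
        rintro s t (hs | rfl) (ht | rfl)
        exacts [Or.inl hs, Or.inl hs, Or.inl ht, Or.inr (add_zero _)]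
       zero_mem' := Or.inr rfl
       smul_mem' := by
        rintro c s (hs | rfl)
        exacts [Or.inl hs, Or.inr (smul_zero _)] } :
      Submodule ℂ (A.obj (op ((Opens.map (inclusionMap X)).obj W.unop))))
  map i := ModuleCat.ofHom ((res A (map_le (inclusionMap X) i.unop.le)).restrict (by
    rintro s (hs | rfl)
    exacts [Or.inl (i.unop.le.trans hs), Or.inr (map_zero _)]))
  map_id W := by
    refine ModuleCat.hom_ext (LinearMap.ext fun s => Subtype.ext ?_)
    exact res_self _ _ _
  map_comp i j := by
    refine ModuleCat.hom_ext (LinearMap.ext fun s => Subtype.ext ?_)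
    exact (res_res _ _ _ _).symm

/-- Extension by zero of a morphism of presheaves. -/
def extendZeroMap {A B : TopCat.Presheaf (ModuleCat.{0} ℂ) (TopCat.of X)} (φ : A ⟶ B) :
    extendZero X A ⟶ extendZero X B where
  app W := ModuleCat.ofHom ((onSections φ _).restrict (by
    rintro s (hs | rfl)
    exacts [Or.inl hs, Or.inr (map_zero _)]))
  naturality _ _ _ := by
    ext s
    exact Subtype.ext (onSections_res φ _ _)

theorem mono_extendZeroMap {A B : TopCat.Presheaf (ModuleCat.{0} ℂ) (TopCat.of X)} (φ : A ⟶ B)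
    (hφ : ∀ U, Function.Injective (onSections φ U)) : Mono (extendZeroMap X φ) := by
  have (W : (Opens (TopCat.of Y))ᵒᵖ) : Mono ((extendZeroMap X φ).app W) := by
    rw [ModuleCat.mono_iff_injective]
    intro s t h
    exact Subtype.ext (hφ _ (congrArg Subtype.val h))
  exact NatTrans.mono_of_mono_app _

variable (I : TopCat.Sheaf (ModuleCat.{0} ℂ) (TopCat.of Y))

/-- Morphisms `A → i⁻¹ I` on `X` extend to morphisms from the extension by zero of `A` to `I`. -/
theorem exists_extendZero_hom {A : TopCat.Presheaf (ModuleCat.{0} ℂ) (TopCat.of X)}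
    (g : A ⟶ (inverseImage (inclusionMap X) I).presheaf) :
    ∃ γ : extendZero X A ⟶ I.presheaf, ∀ (W : Opens (TopCat.of Y)), W ≤ X →
      ∀ s : (extendZero X A).obj (op W),
        unitOn (inclusionMap X) I W (onSections γ W s) = onSections g _ s.1 := by
  classical
  let e (W : Opens (TopCat.of Y)) (hW : W ≤ X) :=
    LinearEquiv.ofBijective (unitOn (inclusionMap X) I W) (unitOn_bijective_of_le X I hW)
  have he (W hW s) : unitOn (inclusionMap X) I W ((e W hW).symm s) = s :=
    (e W hW).apply_symm_apply s
  let γ (W : Opens (TopCat.of Y)) : (extendZero X A).obj (op W) →ₗ[ℂ] I.presheaf.obj (op W) :=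
    if hW : W ≤ X then (e W hW).symm.toLinearMap ∘ₗ onSections g _ ∘ₗ Submodule.subtype _ else 0
  have hγ (W : Opens (TopCat.of Y)) (hW : W ≤ X) (s : (extendZero X A).obj (op W)) :
      unitOn (inclusionMap X) I W (γ W s) = onSections g _ s.1 := by
    simp only [γ, dif_pos hW]
    exact he W hW _
  refine ⟨{ app := fun W => ModuleCat.ofHom (γ W.unop), naturality := fun V W i => ?_ }, hγ⟩
  ext s
  change γ W.unop ((extendZero X A).map i s) = res I.presheaf i.unop.le (γ V.unop s)
  rcases s.2 with hV | hs
  · have hW : W.unop ≤ X := i.unop.le.trans hV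
    apply unitOn_injective_of_le X I hW
    refine (hγ _ hW _).trans (Eq.trans ?_ (unitOn_res _ _ _ _).symm)
    rw [hγ _ hV]
    exact onSections_res g _ s.1
  · have hs : s = 0 := Subtype.ext hs
    rw [hs, map_zero, map_zero, map_zero, map_zero]

/-- An injective sheaf is injective as a presheaf, because sheafification is exact. -/
theorem injective_presheaf {X : TopCat.{0}} (I : TopCat.Sheaf (ModuleCat.{0} ℂ) X) [Injective I] :
    Injective I.presheaf :=
  @Injective.injective_of_adjoint _ _ _ _ _ _
    (inferInstance : (presheafToSheaf (Opens.grothendieckTopology X)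
      (ModuleCat.{0} ℂ)).PreservesMonomorphisms)
    (sheafificationAdjunction (Opens.grothendieckTopology X) (ModuleCat.{0} ℂ)) I ‹_›

theorem onSections_injective_of_mono {X : TopCat.{0}} {A B : TopCat.Sheaf (ModuleCat.{0} ℂ) X}
    (φ : A ⟶ B) [Mono φ] (U : Opens X) : Function.Injective (onSections φ.hom U) := by
  have : Mono φ.hom := inferInstanceAs (Mono ((TopCat.Sheaf.forget _ _).map φ))
  exact (ModuleCat.mono_iff_injective _).1 (inferInstanceAs (Mono (φ.hom.app (op U))))

/-- The restriction of an injective sheaf to an open subset is injective, since extension by zero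
preserves monomorphisms. -/
theorem injective_inverseImage [Injective I] : Injective (inverseImage (inclusionMap X) I) := by
  have := injective_presheaf I
  refine ⟨fun {A B} g φ _ => ?_⟩
  obtain ⟨γ, hγ⟩ := exists_extendZero_hom X I g.hom
  have := mono_extendZeroMap X φ.hom (onSections_injective_of_mono φ)
  obtain ⟨ψ, hψ⟩ := Injective.factors γ (extendZeroMap X φ.hom)
  let J := inverseImage (inclusionMap X) I
  let lift (U : Opens X) (hW : (Opens.map (inclusionMap X)).obj (imageOpens X U) ≤ U) :
      B.presheaf.obj (op U) →ₗ[ℂ] (extendZero X B.presheaf).obj (op (imageOpens X U)) :=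
    (res B.presheaf hW).codRestrict _ fun _ => Or.inl (imageOpens_le X U)
  let χ (U : Opens X) : B.presheaf.obj (op U) →ₗ[ℂ] J.presheaf.obj (op U) :=
    res J.presheaf (map_imageOpens X U).ge ∘ₗ unitOn (inclusionMap X) I (imageOpens X U) ∘ₗ
      onSections ψ _ ∘ₗ lift U (map_imageOpens X U).le
  refine ⟨⟨{ app := fun U => ModuleCat.ofHom (χ U.unop), naturality := fun V U i => ?_ }⟩, ?_⟩
  · ext b
    change χ U.unop (res B.presheaf i.unop.le b) = res J.presheaf i.unop.le (χ V.unop b)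
    have hUV : imageOpens X U.unop ≤ imageOpens X V.unop := Set.image_mono i.unop.le
    have h1 : lift U.unop (map_imageOpens X _).le (res B.presheaf i.unop.le b) =
        res (extendZero X B.presheaf) hUV (lift V.unop (map_imageOpens X _).le b) :=
      Subtype.ext ((res_res _ _ _ _).trans (res_res _ _ _ _).symm)
    simp only [χ, LinearMap.comp_apply]
    rw [h1, onSections_res, unitOn_res, res_res, res_res]
  · refine ObjectProperty.hom_ext _ (NatTrans.ext (funext fun U =>
      ModuleCat.hom_ext (LinearMap.ext fun a => ?_)))
    change χ U.unop (onSections φ.hom _ a) = onSections g.hom _ a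
    let a' : (extendZero X A.presheaf).obj (op (imageOpens X U.unop)) :=
      ⟨res A.presheaf (map_imageOpens X U.unop).le a, Or.inl (imageOpens_le X _)⟩
    have h1 : lift U.unop (map_imageOpens X _).le (onSections φ.hom _ a) =
        onSections (extendZeroMap X φ.hom) _ a' :=
      Subtype.ext (onSections_res φ.hom _ a).symm
    have h2 : onSections ψ _ (onSections (extendZeroMap X φ.hom) _ a') = onSections γ _ a' := by
      rw [← hψ]; rfl
    simp only [χ, LinearMap.comp_apply]
    rw [h1, h2, hγ _ (imageOpens_le X _)]
    rw [onSections_res g.hom, res_res]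
    exact res_self _ _ _

/-- The constant presheaf with value `ℂ`. -/
def constPresheaf (X : TopCat.{0}) : TopCat.Presheaf (ModuleCat.{0} ℂ) X :=
  (Functor.const _).obj (ModuleCat.of ℂ ℂ)

/-- Injective sheaves are flasque: a section over `U` is a morphism from the extension by zero of
the constant presheaf on `U`, which is a subpresheaf of the constant presheaf. -/
theorem res_surjective_of_injective [Injective I] (U : Opens (TopCat.of Y)) :
    Function.Surjective (res I.presheaf (le_top : U ≤ ⊤)) := by
  intro s
  have := injective_presheaf I
  let J := inverseImage (inclusionMap U) I
  have hU (W : Opens U) : W ≤ (Opens.map (inclusionMap U)).obj U := fun x _ => x.2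
  let g : constPresheaf (TopCat.of U) ⟶ J.presheaf :=
    { app := fun W => ModuleCat.ofHom (LinearMap.toSpanSingleton ℂ _
        (res J.presheaf (hU W.unop) (unitOn (inclusionMap U) I U s)))
      naturality := fun V W i => by
        ext
        change (1 : ℂ) • _ = res J.presheaf i.unop.le ((1 : ℂ) • _)
        rw [one_smul, one_smul, res_res] }
  obtain ⟨γ, hγ⟩ := exists_extendZero_hom U I g
  let ι : extendZero U (constPresheaf (TopCat.of U)) ⟶ constPresheaf (TopCat.of Y) :=
    { app := fun W => ModuleCat.ofHom (Submodule.subtype _)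
      naturality := fun V W i => rfl }
  have (W : (Opens (TopCat.of Y))ᵒᵖ) : Mono (ι.app W) := by
    rw [ModuleCat.mono_iff_injective]
    exact Subtype.val_injective
  have : Mono ι := NatTrans.mono_of_mono_app _
  obtain ⟨ψ, hψ⟩ := Injective.factors γ ι
  refine ⟨onSections ψ ⊤ (1 : ℂ), ?_⟩
  refine (onSections_res ψ le_top _).symm.trans ?_
  let a : (extendZero U (constPresheaf (TopCat.of U))).obj (op U) := ⟨(1 : ℂ), Or.inl le_rfl⟩
  have h1 : onSections ψ U (1 : ℂ) = onSections γ U a := by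
    rw [← hψ]; rfl
  refine h1.trans (unitOn_injective_of_le U I le_rfl ?_)
  refine (hγ U le_rfl a).trans ?_
  change (1 : ℂ) • res J.presheaf _ (unitOn (inclusionMap U) I U s) = unitOn (inclusionMap U) I U s
  rw [one_smul]
  exact res_self _ _ _

end ExtensionByZero

/-! ### Cocycles in injective resolutions -/

section Homology

/-- The first homology of a cochain complex of vector spaces is the quotient of the cocycles by the
coboundaries. -/
theorem exists_cocycles_to_homology (K : CochainComplex (ModuleCat.{0} ℂ) ℕ) :
    ∃ π : LinearMap.ker (K.d 1 2).hom →ₗ[ℂ] K.homology 1, Function.Surjective π ∧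
      ∀ z, π z = 0 ↔ ∃ y, (K.d 0 1).hom y = z.1 := by
  let S := K.sc' 0 1 2
  let e : K.homology 1 ≅ S.moduleCatLeftHomologyData.H :=
    K.homologyIsoSc' 0 1 2 (by simp) (by simp) ≪≫ S.moduleCatHomologyIso
  refine ⟨e.toLinearEquiv.symm.toLinearMap ∘ₗ Submodule.mkQ _,
    e.toLinearEquiv.symm.surjective.comp (Submodule.mkQ_surjective _), fun z => ?_⟩
  refine (LinearEquiv.map_eq_zero_iff e.toLinearEquiv.symm).trans
    ((Submodule.Quotient.mk_eq_zero _).trans ?_)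
  exact ⟨fun ⟨y, hy⟩ => ⟨y, congrArg Subtype.val hy⟩, fun ⟨y, hy⟩ => ⟨y, Subtype.ext hy⟩⟩

/-- Cocycles represent the first right derived functor, which can be computed from any injective
resolution. -/
theorem exists_cocycles_to_rightDerived {X : TopCat.{0}}
    (T : TopCat.Sheaf (ModuleCat.{0} ℂ) X ⥤ ModuleCat.{0} ℂ) [T.Additive]
    {F : TopCat.Sheaf (ModuleCat.{0} ℂ) X} (I : InjectiveResolution F) :
    ∃ π : LinearMap.ker (T.map (I.cocomplex.d 1 2)).hom →ₗ[ℂ] (T.rightDerived 1).obj F,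
      Function.Surjective π ∧
      ∀ z, π z = 0 ↔ ∃ y, (T.map (I.cocomplex.d 0 1)).hom y = z.1 := by
  obtain ⟨π, hπ, h⟩ := exists_cocycles_to_homology
    ((T.mapHomologicalComplex (ComplexShape.up ℕ)).obj I.cocomplex)
  let e := (I.isoRightDerivedObj T 1).toLinearEquiv.symm
  refine ⟨e.toLinearMap ∘ₗ π, e.surjective.comp hπ, fun z => ?_⟩
  exact (LinearEquiv.map_eq_zero_iff e).trans (h z)

/-- Sections killed by the first differential of a resolution come from the resolved sheaf. -/
theorem exists_onSections_ι_eq {X : TopCat.{0}} {F : TopCat.Sheaf (ModuleCat.{0} ℂ) X}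
    (I : InjectiveResolution F) (U : Opens X) (t : (I.cocomplex.X 0).presheaf.obj (op U))
    (ht : onSections (I.cocomplex.d 0 1).hom U t = 0) :
    ∃ a : F.presheaf.obj (op U), onSections (I.ι.f 0).hom U a = t := by
  let T : TopCat.Sheaf (ModuleCat.{0} ℂ) X ⥤ ModuleCat.{0} ℂ :=
    TopCat.Sheaf.forget (ModuleCat.{0} ℂ) X ⋙ (evaluation _ _).obj (op U)
  have : T.Additive := ⟨rfl⟩
  have : Limits.PreservesFiniteLimits (TopCat.Sheaf.forget (ModuleCat.{0} ℂ) X) := inferInstance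
  have : Limits.PreservesFiniteLimits
    ((evaluation (Opens X)ᵒᵖ (ModuleCat.{0} ℂ)).obj (op U)) := ⟨fun _ => inferInstance⟩
  have : Limits.PreservesFiniteLimits T := Limits.comp_preservesFiniteLimits _ _
  have h := I.exact₀.map_of_mono_of_preservesKernel T inferInstance inferInstance
  exact (ShortComplex.moduleCat_exact_iff _).1 h t ht

attribute [local instance] Limits.reflectsLimits_of_reflectsIsomorphisms in
theorem preservesFiniteLimits_pullback {X Y : TopCat.{0}} (f : X ⟶ Y) :
    Limits.PreservesFiniteLimits (TopCat.Sheaf.pullback (ModuleCat.{0} ℂ) f) := by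
  have : Limits.PreservesFiniteLimits
      ((Opens.map f).op.lan : _ ⥤ (Opens X)ᵒᵖ ⥤ ModuleCat.{0} ℂ) :=
    lan_preservesFiniteLimits_of_flat _ _
  exact Functor.sheafPullbackConstruction.preservesFiniteLimits (Opens.map f) (ModuleCat.{0} ℂ)
    (Opens.grothendieckTopology Y) (Opens.grothendieckTopology X)

/-- The restriction of an injective resolution to an open subset. -/
def restrictResolution {Y : Type} [TopologicalSpace Y] (X : Opens Y)
    {F : TopCat.Sheaf (ModuleCat.{0} ℂ) (TopCat.of Y)} (I : InjectiveResolution F) :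
    InjectiveResolution (inverseImage (inclusionMap X) F) :=
  let T := TopCat.Sheaf.pullback (ModuleCat.{0} ℂ) (inclusionMap X)
  have : Limits.PreservesFiniteLimits T :=
    preservesFiniteLimits_pullback _
  have : T.Additive := Functor.additive_of_preserves_binary_products T
  have : T.PreservesHomology := inferInstance
  { cocomplex := (T.mapHomologicalComplex _).obj I.cocomplex
    injective := fun n => injective_inverseImage X (I.cocomplex.X n)
    ι := (HomologicalComplex.singleMapHomologicalComplex T (ComplexShape.up ℕ) 0).inv.app F ≫
      (T.mapHomologicalComplex (ComplexShape.up ℕ)).map I.ι }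

end Homology

/-! ### The obstruction to extending a section over a compact set -/

section CompactSupports

/-- Sections of `G` over the complement of a compact set have an obstruction class in `H¹_c`: extend
the section to a global section of the first term of an injective resolution and differentiate. If
the class vanishes, the section agrees with a global section of `G` outside a compact set. -/
theorem exists_lift_to_compactCohomology {M : Type} [TopologicalSpace M]
    (G : TopCat.Sheaf (ModuleCat.{0} ℂ) (TopCat.of M)) (U : Opens (TopCat.of M))
    (hU : IsCompact ((U : Set M)ᶜ)) :
    ∃ φ : G.presheaf.obj (op U) →ₗ[ℂ] compactCohomology 1 G, ∀ f, φ f = 0 →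
      ∃ (V : Opens (TopCat.of M)) (g : G.presheaf.obj (op ⊤)), IsCompact ((V : Set M)ᶜ) ∧
        res G.presheaf (inf_le_left : U ⊓ V ≤ U) f = res G.presheaf le_top g := by
  obtain ⟨I⟩ : Nonempty (InjectiveResolution G) := HasInjectiveResolution.out
  obtain ⟨π, -, hπ⟩ := exists_cocycles_to_rightDerived (compactSections (TopCat.of M)) I
  obtain ⟨σ, hσ⟩ := LinearMap.exists_rightInverse_of_surjective _
    (LinearMap.range_eq_top.2 (res_surjective_of_injective (I.cocomplex.X 0) U))
  have hd (W : Opens (TopCat.of M)) (a : G.presheaf.obj (op W)) :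
      onSections (I.cocomplex.d 0 1).hom W (onSections (I.ι.f 0).hom W a) = 0 :=
    congrArg (fun ψ => (ψ.hom.app (op W)).hom a) I.ι_f_zero_comp_complex_d
  have hdd (W : Opens (TopCat.of M)) (a : (I.cocomplex.X 0).presheaf.obj (op W)) :
      onSections (I.cocomplex.d 1 2).hom W (onSections (I.cocomplex.d 0 1).hom W a) = 0 :=
    congrArg (fun ψ => (ψ.hom.app (op W)).hom a) (I.cocomplex.d_comp_d 0 1 2)
  let T : G.presheaf.obj (op U) →ₗ[ℂ] (I.cocomplex.X 0).presheaf.obj (op ⊤) :=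
    σ ∘ₗ onSections (I.ι.f 0).hom U
  have hT (f) : res (I.cocomplex.X 0).presheaf le_top (T f) = onSections (I.ι.f 0).hom U f :=
    LinearMap.congr_fun hσ _
  let c₁ : G.presheaf.obj (op U) →ₗ[ℂ] compactlySupported (I.cocomplex.X 1) :=
    (onSections (I.cocomplex.d 0 1).hom ⊤ ∘ₗ T).codRestrict _ fun f => ⟨U, hU, by
      refine (onSections_res _ le_top _).symm.trans ?_
      rw [hT, hd]⟩
  let c₂ : G.presheaf.obj (op U) →ₗ[ℂ]
      LinearMap.ker ((compactSections (TopCat.of M)).map (I.cocomplex.d 1 2)).hom :=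
    LinearMap.codRestrict _ c₁ fun f => Subtype.ext (hdd _ _)
  refine ⟨π ∘ₗ c₂, fun f hf => ?_⟩
  obtain ⟨⟨y, V, hV, hyV⟩, hy⟩ := (hπ _).1 hf
  have hy' : onSections (I.cocomplex.d 0 1).hom ⊤ y = onSections (I.cocomplex.d 0 1).hom ⊤ (T f) :=
    congrArg Subtype.val hy
  obtain ⟨g, hg⟩ := exists_onSections_ι_eq I ⊤ (T f - y) (by rw [map_sub, hy', sub_self])
  refine ⟨V, g, hV, onSections_injective_of_mono (I.ι.f 0) _ ?_⟩
  have hyV' : res (I.cocomplex.X 0).presheaf (le_top : U ⊓ V ≤ ⊤) y = 0 := by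
    refine (res_res _ inf_le_right le_top _).symm.trans ?_
    exact (congrArg _ hyV).trans (map_zero _)
  refine (onSections_res _ _ _).trans (Eq.trans ?_ (onSections_res (I.ι.f 0).hom _ _).symm)
  rw [hg, map_sub, hyV', sub_zero]
  refine (congrArg _ (hT f).symm).trans ?_
  exact res_res _ _ _ _

end CompactSupports

/-! ### Extension by zero of compactly supported cohomology -/

section CompactSupports

theorem exists_cocycles_to_cohomology {X : TopCat.{0}} {F : TopCat.Sheaf (ModuleCat.{0} ℂ) X}
    (I : InjectiveResolution F) :
    ∃ π : LinearMap.ker (onSections (I.cocomplex.d 1 2).hom ⊤) →ₗ[ℂ] cohomology 1 F,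
      Function.Surjective π ∧
      ∀ z, π z = 0 ↔ ∃ y, onSections (I.cocomplex.d 0 1).hom ⊤ y = z.1 :=
  exists_cocycles_to_rightDerived (globalSections X) I

/-- Compactly supported cocycles of an injective resolution represent the classes in `H¹_c`. -/
theorem exists_cocycles_to_compactCohomology {X : TopCat.{0}}
    {F : TopCat.Sheaf (ModuleCat.{0} ℂ) X} (I : InjectiveResolution F) :
    ∃ π : ↥(compactlySupported (I.cocomplex.X 1) ⊓
        LinearMap.ker (onSections (I.cocomplex.d 1 2).hom ⊤)) →ₗ[ℂ] compactCohomology 1 F,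
      Function.Surjective π ∧ ∀ z, π z = 0 ↔
        ∃ y ∈ compactlySupported (I.cocomplex.X 0),
          onSections (I.cocomplex.d 0 1).hom ⊤ y = z.1 := by
  obtain ⟨π, hπ, h⟩ := exists_cocycles_to_rightDerived (compactSections X) I
  let κ : ↥(compactlySupported (I.cocomplex.X 1) ⊓
        LinearMap.ker (onSections (I.cocomplex.d 1 2).hom ⊤)) →ₗ[ℂ]
      LinearMap.ker ((compactSections X).map (I.cocomplex.d 1 2)).hom :=
    LinearMap.codRestrict _ (Submodule.inclusion inf_le_left) fun z => Subtype.ext z.2.2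
  refine ⟨π ∘ₗ κ, hπ.comp fun z => ⟨⟨z.1.1, z.1.2, congrArg Subtype.val z.2⟩, rfl⟩, fun z => ?_⟩
  refine (h (κ z)).trans ⟨fun ⟨y, hy⟩ => ⟨y.1, y.2, congrArg Subtype.val hy⟩, fun ⟨y, hy, hyz⟩ =>
    ⟨⟨y, hy⟩, Subtype.ext hyz⟩⟩

variable {Y : Type} [TopologicalSpace Y] (Z : Closeds Y)

theorem mem_or_mem_of_subset {X : Opens Y} (hX : X = Z.compl) {W : Opens Y} (hW : (Z : Set Y) ⊆ W)
    (x : Y) : x ∈ X ∨ x ∈ W := by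
  by_cases hx : x ∈ Z
  · exact Or.inr (hW hx)
  · left; rw [hX]; exact hx

variable (F : TopCat.Sheaf (ModuleCat.{0} ℂ) (TopCat.of Y))

/-- If every section of `j⁻¹ F` on `Z` comes from a global section of `F`, then every section of
`F` near `Z` agrees with a global section near `Z`. -/
theorem exists_global_section_near_closed
    (hF : Function.Surjective (sectionsPullback (inclusionMap Z) F)) {V : Opens (TopCat.of Y)}
    (hV : (Z : Set Y) ⊆ V) (a : F.presheaf.obj (op V)) :
    ∃ (W : Opens (TopCat.of Y)) (hW : W ≤ V) (g : F.presheaf.obj (op ⊤)), (Z : Set Y) ⊆ W ∧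
      res F.presheaf hW a = res F.presheaf le_top g := by
  obtain ⟨g, hg⟩ : ∃ g : F.presheaf.obj (op ⊤), unitOn (inclusionMap Z) F ⊤ g =
      res (inverseImage (inclusionMap Z) F).presheaf (top_le_map_inclusionMap Z hV)
        (unitOn (inclusionMap Z) F V a) := hF _
  obtain ⟨W, hW, hZW, h⟩ := exists_res_eq_zero_near_closed Z F hV (a - res F.presheaf le_top g) (by
    rw [map_sub, unitOn_res, hg, sub_eq_zero]
    exact ((res_res _ _ _ _).trans (res_self _ _ _)).symm)
  refine ⟨W, hW, g, hZW, ?_⟩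
  rw [map_sub, sub_eq_zero] at h
  exact h.trans (res_res _ _ _ _)

/-- The global sections of `F` that vanish on a neighbourhood of `Z`. -/
def vanishingNear : Submodule ℂ (F.presheaf.obj (op ⊤)) where
  carrier := {s | ∃ W : Opens (TopCat.of Y), (Z : Set Y) ⊆ W ∧
    res F.presheaf (le_top : W ≤ ⊤) s = 0}
  add_mem' := by
    rintro s t ⟨W, hW, hs⟩ ⟨W', hW', ht⟩
    refine ⟨W ⊓ W', fun z hz => ⟨hW hz, hW' hz⟩, ?_⟩
    rw [map_add, ← res_res _ inf_le_left (le_top : W ≤ ⊤), hs,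
      ← res_res _ inf_le_right (le_top : W' ≤ ⊤), ht, map_zero, map_zero, add_zero]
  zero_mem' := ⟨⊤, fun _ _ => trivial, map_zero _⟩
  smul_mem' := by
    rintro c s ⟨W, hW, hs⟩
    exact ⟨W, hW, by rw [map_smul, hs, smul_zero]⟩

theorem onSections_mem_vanishingNear {F G : TopCat.Sheaf (ModuleCat.{0} ℂ) (TopCat.of Y)}
    (φ : F ⟶ G) {s : F.presheaf.obj (op ⊤)} (hs : s ∈ vanishingNear Z F) :
    onSections φ.hom ⊤ s ∈ vanishingNear Z G := by
  obtain ⟨W, hW, h⟩ := hs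
  exact ⟨W, hW, (onSections_res φ.hom le_top s).symm.trans ((congrArg _ h).trans (map_zero _))⟩

theorem eq_zero_of_vanishingNear {X : Opens Y} (hX : X = Z.compl) {s : F.presheaf.obj (op ⊤)}
    (hs : s ∈ vanishingNear Z F) (h : unitOn (inclusionMap X) F ⊤ s = 0) : s = 0 := by
  obtain ⟨W, hW, hsW⟩ := hs
  refine eq_of_locally_eq F fun x _ => ?_
  rcases mem_or_mem_of_subset Z hX hW x with hx | hx
  · refine ⟨X, le_top, hx, unitOn_injective_of_le X F le_rfl ?_⟩
    rw [unitOn_res, h, map_zero, map_zero, map_zero]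
  · exact ⟨W, le_top, hx, hsW.trans (map_zero _).symm⟩

/-- Sections of `F` vanishing near `Z` restrict to sections with compact support on the complement
of `Z`. -/
theorem unitOn_mem_compactlySupported [CompactSpace Y] {X : Opens Y} (hX : X = Z.compl)
    {s : F.presheaf.obj (op ⊤)} (hs : s ∈ vanishingNear Z F) :
    unitOn (inclusionMap X) F ⊤ s ∈ compactlySupported (inverseImage (inclusionMap X) F) := by
  obtain ⟨W, hW, hsW⟩ := hs
  refine ⟨(Opens.map (inclusionMap X)).obj W, ?_, ?_⟩
  · refine Topology.IsInducing.subtypeVal.isCompact_iff.2 ?_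
    have : Subtype.val '' (((Opens.map (inclusionMap X)).obj W : Set X)ᶜ) = (W : Set Y)ᶜ := by
      ext y
      constructor
      · rintro ⟨y, hy, rfl⟩; exact hy
      · intro hy
        exact ⟨⟨y, (mem_or_mem_of_subset Z hX hW y).resolve_right hy⟩, hy, rfl⟩
    exact (congrArg IsCompact this).mpr W.2.isClosed_compl.isCompact
  · exact (unitOn_res (inclusionMap X) F le_top s).symm.trans ((congrArg _ hsW).trans (map_zero _))

/-- Sections with compact support on the complement of `Z` extend by zero. -/
theorem exists_vanishingNear_unitOn_eq [T2Space Y] {X : Opens Y} (hX : X = Z.compl)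
    (c : (inverseImage (inclusionMap X) F).presheaf.obj (op ⊤))
    (hc : c ∈ compactlySupported (inverseImage (inclusionMap X) F)) :
    ∃ s ∈ vanishingNear Z F, unitOn (inclusionMap X) F ⊤ s = c := by
  obtain ⟨U, hU, hcU⟩ := hc
  let W : Opens (TopCat.of Y) := ⟨(Subtype.val '' ((U : Set X)ᶜ))ᶜ,
    (hU.image continuous_subtype_val).isClosed.isOpen_compl⟩
  have hZW : (Z : Set Y) ⊆ W := by
    rintro z hz ⟨x, -, rfl⟩
    exact hX.le x.2 hz
  have hWU : (Opens.map (inclusionMap X)).obj (X ⊓ W) ≤ U := by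
    intro x hx
    by_contra h
    exact hx.2 ⟨x, h, rfl⟩
  obtain ⟨s₀, hs₀⟩ := (unitOn_bijective_of_le X F le_rfl).2
    (res (inverseImage (inclusionMap X) F).presheaf le_top c)
  change unitOn (inclusionMap X) F X s₀ = _ at hs₀
  have h0 : res F.presheaf (inf_le_left : X ⊓ W ≤ X) s₀ = 0 := by
    refine unitOn_injective_of_le X F inf_le_left ?_
    rw [unitOn_res, hs₀, map_zero]
    refine (res_res _ _ _ _).trans ((res_res _ hWU le_top c).symm.trans ?_)
    exact (congrArg _ hcU).trans (map_zero _)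
  obtain ⟨s, hs⟩ := exists_gluing F (fun b : Bool => if b then X else W) ⊤ (fun _ => le_top)
    (fun x _ => Opens.mem_iSup.2 <| (mem_or_mem_of_subset Z hX hZW x).elim
      (fun h => ⟨true, h⟩) (fun h => ⟨false, h⟩))
    (fun b => match b with | true => s₀ | false => 0) (by
      rintro (_ | _) (_ | _)
      · rfl
      · refine (map_zero _).trans (Eq.symm ?_)
        refine (res_res F.presheaf (le_inf inf_le_right inf_le_left) inf_le_left s₀).symm.trans ?_
        exact (congrArg _ h0).trans (map_zero _)
      · exact h0.trans (map_zero _).symm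
      · rfl)
  refine ⟨s, ⟨W, hZW, hs false⟩, ?_⟩
  refine eq_of_locally_eq _ fun x _ => ⟨(Opens.map (inclusionMap X)).obj X, le_top, x.2, ?_⟩
  refine (unitOn_res (inclusionMap X) F le_top s).symm.trans (Eq.trans ?_ hs₀)
  exact congrArg _ (hs true)

/-- Extension by zero of compactly supported sections, as a linear map. -/
theorem exists_extendByZero [T2Space Y] [CompactSpace Y] {X : Opens Y} (hX : X = Z.compl) :
    ∃ e : compactlySupported (inverseImage (inclusionMap X) F) →ₗ[ℂ] F.presheaf.obj (op ⊤),
      ∀ c, e c ∈ vanishingNear Z F ∧ unitOn (inclusionMap X) F ⊤ (e c) = c.1 := by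
  let r : vanishingNear Z F →ₗ[ℂ] compactlySupported (inverseImage (inclusionMap X) F) :=
    (unitOn (inclusionMap X) F ⊤).restrict fun s hs => unitOn_mem_compactlySupported Z _ hX hs
  have hr : Function.Bijective r := by
    refine ⟨(injective_iff_map_eq_zero _).2 fun s hs => Subtype.ext ?_, fun c => ?_⟩
    · exact eq_zero_of_vanishingNear Z _ hX s.2 (congrArg Subtype.val hs)
    · obtain ⟨s, hs, h⟩ := exists_vanishingNear_unitOn_eq Z _ hX c.1 c.2
      exact ⟨⟨s, hs⟩, Subtype.ext h⟩
  let e := LinearEquiv.ofBijective r hr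
  exact ⟨Submodule.subtype _ ∘ₗ e.symm.toLinearMap, fun c =>
    ⟨(e.symm c).2, congrArg Subtype.val (e.apply_symm_apply c)⟩⟩

/-- If the differential of `t` vanishes near `Z`, it is also the differential of a section vanishing
near `Z`: near `Z`, the section `t` comes from `F`, and a global section of `F` corrects it. -/
theorem exists_vanishingNear_d_eq (hF : Function.Surjective (sectionsPullback (inclusionMap Z) F))
    (I : InjectiveResolution F) (t : (I.cocomplex.X 0).presheaf.obj (op ⊤))
    (ht : onSections (I.cocomplex.d 0 1).hom ⊤ t ∈ vanishingNear Z (I.cocomplex.X 1)) :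
    ∃ t' ∈ vanishingNear Z (I.cocomplex.X 0),
      onSections (I.cocomplex.d 0 1).hom ⊤ t' = onSections (I.cocomplex.d 0 1).hom ⊤ t := by
  obtain ⟨W, hW, hsW⟩ := ht
  obtain ⟨a, ha⟩ := exists_onSections_ι_eq I W (res _ le_top t) (by
    rw [onSections_res, hsW])
  obtain ⟨W', hW', g, hZW', hg⟩ := exists_global_section_near_closed Z F hF hW a
  refine ⟨t - onSections (I.ι.f 0).hom ⊤ g, ⟨W', hZW', ?_⟩, ?_⟩
  · refine (map_sub _ _ _).trans (sub_eq_zero.2 ?_)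
    refine (res_res _ hW' le_top t).symm.trans ((congrArg _ ha.symm).trans ?_)
    exact (onSections_res _ _ _).symm.trans ((congrArg _ hg).trans (onSections_res _ _ _))
  · refine (map_sub _ _ _).trans (sub_eq_self.2 ?_)
    exact congrArg (fun ψ => (ψ.hom.app (op ⊤)).hom g) I.ι_f_zero_comp_complex_d

/-- An injective resolution of `F` also computes the compactly supported cohomology of `i⁻¹ F`. -/
theorem exists_cocycles_to_compactCohomology_inverseImage {Y : Type} [TopologicalSpace Y]
    (X : Opens Y) {F : TopCat.Sheaf (ModuleCat.{0} ℂ) (TopCat.of Y)} (I : InjectiveResolution F) :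
    ∃ π : ↥(compactlySupported (inverseImage (inclusionMap X) (I.cocomplex.X 1)) ⊓
        LinearMap.ker (onSections ((TopCat.Sheaf.pullback (ModuleCat.{0} ℂ) (inclusionMap X)).map
          (I.cocomplex.d 1 2)).hom ⊤)) →ₗ[ℂ]
        compactCohomology 1 (inverseImage (inclusionMap X) F),
      Function.Surjective π ∧ ∀ z, π z = 0 ↔
        ∃ y ∈ compactlySupported (inverseImage (inclusionMap X) (I.cocomplex.X 0)),
          onSections ((TopCat.Sheaf.pullback (ModuleCat.{0} ℂ) (inclusionMap X)).map
            (I.cocomplex.d 0 1)).hom ⊤ y = z.1 :=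
  exists_cocycles_to_compactCohomology (restrictResolution X I)

/-- If every section of `j⁻¹ F` on `Z` comes from a global section of `F`, then extension by zero
`H¹_c(X, i⁻¹ F) → H¹(Y, F)` is injective. -/
theorem rank_compactCohomology_le [T2Space Y] [CompactSpace Y] {X : Opens Y} (hX : X = Z.compl)
    (hF : Function.Surjective (sectionsPullback (inclusionMap Z) F)) :
    Module.rank ℂ (compactCohomology 1 (inverseImage (inclusionMap X) F)) ≤
      Module.rank ℂ (cohomology 1 F) := by
  obtain ⟨I⟩ : Nonempty (InjectiveResolution F) := HasInjectiveResolution.out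
  obtain ⟨π, -, hπ⟩ := exists_cocycles_to_cohomology I
  obtain ⟨πc, hπc', hπc⟩ := exists_cocycles_to_compactCohomology_inverseImage X I
  obtain ⟨e, he⟩ := exists_extendByZero Z (I.cocomplex.X 1) hX
  let θ := (e ∘ₗ Submodule.inclusion inf_le_left).codRestrict
    (LinearMap.ker (onSections (I.cocomplex.d 1 2).hom ⊤)) fun c : ↥(compactlySupported
        (inverseImage (inclusionMap X) (I.cocomplex.X 1)) ⊓
        LinearMap.ker (onSections ((TopCat.Sheaf.pullback (ModuleCat.{0} ℂ) (inclusionMap X)).map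
          (I.cocomplex.d 1 2)).hom ⊤)) => by
      refine eq_zero_of_vanishingNear Z (I.cocomplex.X 2) hX
        (onSections_mem_vanishingNear Z (I.cocomplex.d 1 2) (he _).1) ?_
      refine (onSections_unitOn (inclusionMap X) (I.cocomplex.d 1 2) ⊤ _).trans
        ((congrArg _ (he _).2).trans ?_)
      exact c.2.2
  have hθ (c) (hc : π (θ c) = 0) : πc c = 0 := by
    obtain ⟨t, ht⟩ := (hπ _).1 hc
    obtain ⟨hs, hsc⟩ := he ⟨c.1, c.2.1⟩
    replace ht : onSections (I.cocomplex.d 0 1).hom ⊤ t = e ⟨c.1, c.2.1⟩ := ht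
    obtain ⟨t', ht', hdt'⟩ := exists_vanishingNear_d_eq Z F hF I t (ht ▸ hs)
    refine (hπc c).2 ⟨_, unitOn_mem_compactlySupported Z _ hX ht', ?_⟩
    refine (onSections_unitOn (inclusionMap X) (I.cocomplex.d 0 1) ⊤ t').symm.trans ?_
    exact (congrArg _ (hdt'.trans ht)).trans hsc
  obtain ⟨σ, hσ⟩ := LinearMap.exists_rightInverse_of_surjective πc (LinearMap.range_eq_top.2 hπc')
  refine LinearMap.rank_le_of_injective (π ∘ₗ θ ∘ₗ σ)
    ((injective_iff_map_eq_zero _).2 fun h hh => ?_)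
  exact (LinearMap.congr_fun hσ h).symm.trans (hθ (σ h) hh)

end CompactSupports

/-! ### Holomorphic functions on convex domains -/

section ConvexDomain
open Set Filter Topology
variable {E : Type*} [NormedAddCommGroup E] [NormedSpace ℂ E]

/-- The complex line through `p` and `q`, parametrized by `0 ↦ p`, `1 ↦ q`. -/
def complexLine (p q : E) (t : ℂ) : E := p + t • (q - p)

theorem complexLine_zero (p q : E) : complexLine p q 0 = p := by simp [complexLine]

theorem complexLine_one (p q : E) : complexLine p q 1 = q := by simp [complexLine]

theorem continuous_complexLine (p q : E) : Continuous (complexLine p q) := by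
  unfold complexLine; fun_prop

theorem differentiable_complexLine (p q : E) : Differentiable ℂ (complexLine p q) := by
  unfold complexLine; fun_prop

theorem convex_preimage_complexLine {B : Set E} (hB : Convex ℝ B) (p q : E) :
    Convex ℝ (complexLine p q ⁻¹' B) := by
  intro s hs t ht a b ha hb hab
  have h : complexLine p q (a • s + b • t) = a • complexLine p q s + b • complexLine p q t := by
    simp only [complexLine, smul_add, add_smul, smul_assoc]
    nth_rewrite 1 [← one_smul ℝ p]
    rw [← hab, add_smul]
    abel
  rw [mem_preimage, h]
  exact hB hs ht ha hb hab

theorem analyticOnNhd_comp_complexLine {B : Set E} (hB : IsOpen B) {f : E → ℂ}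
    (hf : DifferentiableOn ℂ f B) (p q : E) :
    AnalyticOnNhd ℂ (f ∘ complexLine p q) (complexLine p q ⁻¹' B) :=
  (hf.comp (differentiable_complexLine p q).differentiableOn fun _ h => h).analyticOnNhd
    (hB.preimage (continuous_complexLine p q))

/-- The identity theorem on a convex open set, by restriction to complex lines. -/
theorem eqOn_zero_of_convex {B : Set E} (hBo : IsOpen B) (hBc : Convex ℝ B) {f : E → ℂ}
    (hf : DifferentiableOn ℂ f B) {p : E} (hp : p ∈ B) (h0 : ∀ᶠ y in 𝓝 p, f y = 0) :
    ∀ y ∈ B, f y = 0 := by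
  intro q hq
  have ha := analyticOnNhd_comp_complexLine hBo hf p q
  have h := ha.eqOn_zero_of_preconnected_of_eventuallyEq_zero
    (convex_preimage_complexLine hBc p q).isPreconnected
    (z₀ := 0) (by simpa [complexLine_zero] using hp) ?_ (x := 1)
    (by simpa [complexLine_one] using hq)
  · simpa [complexLine_one] using h
  · have : Tendsto (complexLine p q) (𝓝 0) (𝓝 p) := by
      simpa [complexLine_zero] using (continuous_complexLine p q).tendsto 0
    exact this.eventually h0

/-- On a line through a point where `f ≠ 0`, the zeros of `f` are isolated, hence countable. -/
theorem countable_zeros_complexLine {B : Set E} (hBo : IsOpen B) (hBc : Convex ℝ B) {f : E → ℂ}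
    (hf : DifferentiableOn ℂ f B) {p q : E} (hp : p ∈ B) (hfp : f p ≠ 0) :
    {t | complexLine p q t ∈ B ∧ f (complexLine p q t) = 0}.Countable := by
  have h := (analyticOnNhd_comp_complexLine hBo hf p q).preimage_zero_mem_codiscreteWithin
    (x := 0) (by simpa [complexLine_zero] using hfp) (by simpa [complexLine_zero] using hp)
    ⟨⟨0, by simpa [complexLine_zero] using hp⟩,
      (convex_preimage_complexLine hBc p q).isPreconnected⟩
  have hd : IsDiscrete ((f ∘ complexLine p q) ⁻¹' {0} ∩ complexLine p q ⁻¹' B) :=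
    isDiscrete_of_codiscreteWithin h
  have := (HereditarilyLindelofSpace.isLindelof _).countable_of_isDiscrete hd
  refine Set.Countable.mono ?_ this
  exact fun t ht => ⟨by simpa using ht.2, ht.1⟩

/-- The complement, in a convex open set, of a set contained in the zero loci of holomorphic
functions without common zeros outside that set is connected: on the complex line through two given
points, only countably many points have to be avoided. -/
theorem isPreconnected_convex_diff {B Z : Set E} (hBo : IsOpen B) (hBc : Convex ℝ B)
    (hZ : ∀ p ∈ B \ Z, ∃ f : E → ℂ, DifferentiableOn ℂ f B ∧ f p ≠ 0 ∧ ∀ y ∈ B ∩ Z, f y = 0) :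
    IsPreconnected (B \ Z) := by
  refine isPreconnected_of_forall_pair fun p hp q hq => ?_
  obtain ⟨f, hf, hfp, hfZ⟩ := hZ p hp
  set D := complexLine p q ⁻¹' B with hD
  have hDc : Convex ℝ D := convex_preimage_complexLine hBc p q
  have hDo : IsOpen D := hBo.preimage (continuous_complexLine p q)
  have h0 : (0 : ℂ) ∈ D := by simpa [hD, complexLine_zero] using hp.1
  have h1 : (1 : ℂ) ∈ D := by simpa [hD, complexLine_one] using hq.1
  let S := {t | complexLine p q t ∈ B ∧ f (complexLine p q t) = 0}
  have hS : S.Countable := countable_zeros_complexLine hBo hBc hf hp.1 hfp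
  -- The detour from `0` to `1` passes through the point `w s`; each point of `S` excludes at most
  -- two values of `s`.
  let w (s : ℝ) : ℂ := ⟨1 / 2, s⟩
  have hw : Continuous w := by
    have : w = fun s : ℝ => (1 / 2 : ℂ) + s * Complex.I := by
      funext s; apply Complex.ext <;> simp [w]
    rw [this]; fun_prop
  have hw0 : w 0 ∈ D := by
    have := hDc h0 h1 (a := 1 / 2) (b := 1 / 2) (by norm_num) (by norm_num) (by norm_num)
    convert this using 1
    apply Complex.ext <;> simp [w]
  let N : Set ℝ := (fun t : ℂ => t.im / (2 * t.re)) '' S ∪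
    (fun t : ℂ => t.im / (2 * (1 - t.re))) '' S
  have hN : N.Countable := (hS.image _).union (hS.image _)
  obtain ⟨s, hsD, hsN⟩ := (hN.dense_compl ℝ).inter_open_nonempty _ (hDo.preimage hw) ⟨0, hw0⟩
  have hsD : w s ∈ D := hsD
  have hnot (t : ℂ) (ht : t ∈ D) (htS : t ∉ S) : complexLine p q t ∈ B \ Z :=
    ⟨ht, fun h => htS ⟨ht, hfZ _ ⟨ht, h⟩⟩⟩
  refine ⟨complexLine p q '' (segment ℝ 0 (w s) ∪ segment ℝ 1 (w s)), ?_, ?_, ?_, ?_⟩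
  · rintro _ ⟨t, ht | ht, rfl⟩
    · have htD := hDc.segment_subset h0 hsD ht
      obtain ⟨a, b, ha, hb, hab, rfl⟩ := ht
      rcases hb.eq_or_lt with rfl | hb
      · obtain rfl : a = 1 := by linarith
        simpa [complexLine_zero] using hp
      · refine hnot _ htD fun hS => hsN (Or.inl ⟨_, hS, ?_⟩)
        simp [w]; field_simp
    · have htD := hDc.segment_subset h1 hsD ht
      obtain ⟨a, b, ha, hb, hab, rfl⟩ := ht
      rcases hb.eq_or_lt with rfl | hb
      · obtain rfl : a = 1 := by linarith
        simpa [complexLine_one] using hq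
      · refine hnot _ htD fun hS => hsN (Or.inr ⟨_, hS, ?_⟩)
        obtain rfl : a = 1 - b := by linarith
        have hb' : 2 * (1 - (1 - b + b * 2⁻¹)) = b := by ring
        simp [w, hb', hb.ne']
  · exact ⟨0, Or.inl (left_mem_segment _ _ _), complexLine_zero p q⟩
  · exact ⟨1, Or.inr (left_mem_segment _ _ _), complexLine_one p q⟩
  · refine IsPreconnected.image ?_ _ (continuous_complexLine p q).continuousOn
    exact IsPreconnected.union (w s) (right_mem_segment _ _ _) (right_mem_segment _ _ _)
      (convex_segment _ _).isPreconnected (convex_segment _ _).isPreconnected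

/-- Division in one variable: if `g = O(h)` on a disc, the quotient `g / h` extends
holomorphically over the zeros of `h`, and its value at the centre is given by the Cauchy
integral. -/
theorem circleIntegral_div_mul_eq {R r C : ℝ} (hr : 0 < r) (hrR : r < R) {g h : ℂ → ℂ}
    (hg : DifferentiableOn ℂ g (Metric.ball 0 R)) (hh : DifferentiableOn ℂ h (Metric.ball 0 R))
    (hb : ∀ t ∈ Metric.ball (0 : ℂ) R, ‖g t‖ ≤ C * ‖h t‖)
    (hne : ∀ t ∈ Metric.sphere (0 : ℂ) r, h t ≠ 0) :
    (2 * Real.pi * Complex.I)⁻¹ * (∮ t in C(0, r), (t - 0)⁻¹ • (g t / h t)) * h 0 = g 0 := by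
  have hB : IsOpen (Metric.ball (0 : ℂ) R) := Metric.isOpen_ball
  have hrB : (r : ℂ) ∈ Metric.ball (0 : ℂ) R := by simpa [abs_of_pos hr] using hrR
  have hr0 : h r ≠ 0 := hne _ (by simp [abs_of_pos hr])
  have hiso (c : ℂ) (hc : c ∈ Metric.ball (0 : ℂ) R) : ∀ᶠ t in 𝓝[≠] c, h t ≠ 0 := by
    refine ((hh.analyticOnNhd hB c hc).eventually_eq_zero_or_eventually_ne_zero).resolve_left
      fun h0 => hr0 ?_
    exact eqOn_zero_of_convex hB (convex_ball _ _) hh hc h0 _ hrB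
  let Φ (c : ℂ) : ℂ := limUnder (𝓝[≠] c) fun t => g t / h t
  have hΦ (c : ℂ) (hc : c ∈ Metric.ball (0 : ℂ) R) (h0 : h c ≠ 0) : Φ c = g c / h c := by
    have : ContinuousAt (fun t => g t / h t) c :=
      ((hg.differentiableAt (hB.mem_nhds hc)).continuousAt).div
        (hh.differentiableAt (hB.mem_nhds hc)).continuousAt h0
    exact (this.tendsto.mono_left nhdsWithin_le_nhds).limUnder_eq
  have hΦd : DifferentiableOn ℂ Φ (Metric.ball 0 R) := by
    intro c hc
    obtain ⟨s, hs, hsn⟩ := mem_nhdsWithin_iff_exists_mem_nhds_inter.1 (hiso c hc)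
    have hs' : s ∩ Metric.ball 0 R ∈ 𝓝 c := inter_mem hs (hB.mem_nhds hc)
    have hd := Complex.differentiableOn_update_limUnder_of_bddAbove
      (f := fun t => g t / h t) hs' ?_ ?_
    · have heq : Function.update (fun t => g t / h t) c (Φ c) =ᶠ[𝓝 c] Φ := by
        filter_upwards [hs'] with t ht
        rcases eq_or_ne t c with rfl | htc
        · simp
        · rw [Function.update_of_ne htc, hΦ t ht.2 (hsn ⟨ht.1, htc⟩)]
      exact ((hd.differentiableAt hs').congr_of_eventuallyEq heq.symm).differentiableWithinAt
    · intro t ht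
      exact ((hg.differentiableAt (hB.mem_nhds ht.1.2)).div
        (hh.differentiableAt (hB.mem_nhds ht.1.2)) (hsn ⟨ht.1.1, ht.2⟩)).differentiableWithinAt
    · refine ⟨C, ?_⟩
      rintro _ ⟨t, ht, rfl⟩
      have : 0 < ‖h t‖ := norm_pos_iff.2 (hsn ⟨ht.1.1, ht.2⟩)
      simp only [Function.comp_apply, norm_div]
      rw [div_le_iff₀ this]
      exact hb t ht.1.2
  have hint : (∮ t in C(0, r), (t - 0)⁻¹ • (g t / h t)) = (2 * Real.pi * Complex.I : ℂ) • Φ 0 := by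
    rw [← (hΦd.mono (Metric.closedBall_subset_ball hrR)).circleIntegral_sub_inv_smul
      (Metric.mem_ball_self hr)]
    refine circleIntegral.integral_congr hr.le fun t ht => ?_
    have htB : t ∈ Metric.ball (0 : ℂ) R :=
      Metric.closedBall_subset_ball hrR (Metric.sphere_subset_closedBall ht)
    simp only [hΦ t htB (hne t ht)]
  rw [hint, smul_eq_mul, inv_mul_cancel_left₀ Complex.two_pi_I_ne_zero]
  have h0B : (0 : ℂ) ∈ Metric.ball (0 : ℂ) R := Metric.mem_ball_self (hr.trans hrR)
  by_cases h0 : h 0 = 0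
  · have := hb 0 h0B
    rw [h0, norm_zero, mul_zero] at this
    rw [h0, mul_zero, norm_le_zero_iff.1 this]
  · rw [hΦ 0 h0B h0, div_mul_cancel₀ _ h0]

/-- Cauchy's estimate for the derivative of a bounded holomorphic function. -/
theorem norm_fderiv_le_of_bounded {Ω : Set E} {G : E → ℂ} {C ρ : ℝ} (hρ : 0 < ρ) (hΩ : IsOpen Ω)
    (hG : DifferentiableOn ℂ G Ω) (hC : ∀ y ∈ Ω, ‖G y‖ ≤ C) {z : E}
    (hz : Metric.closedBall z ρ ⊆ Ω) : ‖fderiv ℂ G z‖ ≤ C / ρ := by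
  have hzΩ : z ∈ Ω := hz (Metric.mem_closedBall_self hρ.le)
  have hC0 : 0 ≤ C := (norm_nonneg _).trans (hC z hzΩ)
  refine ContinuousLinearMap.opNorm_le_bound _ (by positivity) fun w => ?_
  rcases eq_or_ne w 0 with rfl | hw
  · simp
  have hw' : 0 < ‖w‖ := norm_pos_iff.2 hw
  have hmem (s : ℂ) (hs : s ∈ Metric.closedBall (0 : ℂ) (ρ / ‖w‖)) : z + s • w ∈ Ω := by
    refine hz ?_
    rw [mem_closedBall_zero_iff, le_div_iff₀ hw'] at hs
    simpa [norm_smul] using hs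
  have hl (s : ℂ) : HasDerivAt (fun s : ℂ => z + s • w) w s := by
    simpa using ((hasDerivAt_id s).smul_const w).const_add z
  have hd : DifferentiableOn ℂ (fun s : ℂ => G (z + s • w)) (Metric.closedBall 0 (ρ / ‖w‖)) :=
    fun s hs => ((hG.differentiableAt (hΩ.mem_nhds (hmem s hs))).comp s
      (hl s).differentiableAt).differentiableWithinAt
  have hderiv : deriv (fun s : ℂ => G (z + s • w)) 0 = fderiv ℂ G z w := by
    have h1 : HasFDerivAt G (fderiv ℂ G z) (z + (0 : ℂ) • w) := by
      simpa using (hG.differentiableAt (hΩ.mem_nhds hzΩ)).hasFDerivAt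
    exact (h1.comp_hasDerivAt 0 (hl 0)).deriv
  have := Complex.norm_deriv_le_of_forall_mem_sphere_norm_le (c := 0) (R := ρ / ‖w‖) (C := C)
    (by positivity) (hd.mono Metric.closure_ball_subset_closedBall).diffContOnCl
    (fun s hs => hC _ (hmem s (Metric.sphere_subset_closedBall hs)))
  rw [hderiv] at this
  exact this.trans (by rw [div_div_eq_mul_div, div_mul_eq_mul_div])

/-- A circle integral of a bounded holomorphic function of several variables depends
holomorphically on parameters. -/
theorem differentiableAt_circleIntegral [FiniteDimensional ℂ E] {Ω : Set E} {G : E → ℂ} {C r : ℝ}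
    (hr : 0 < r) (hΩ : IsOpen Ω) (hG : DifferentiableOn ℂ G Ω) (hC : ∀ y ∈ Ω, ‖G y‖ ≤ C) {x v : E}
    (hx : ∀ t ∈ Metric.sphere (0 : ℂ) r, x + t • v ∈ Ω) :
    DifferentiableAt ℂ (fun y => ∮ t in C(0, r), (t - 0)⁻¹ • G (y + t • v)) x := by
  borelize E
  have hK : IsCompact ((fun t : ℂ => x + t • v) '' Metric.sphere (0 : ℂ) r) :=
    (isCompact_sphere _ _).image (by fun_prop)
  obtain ⟨δ, hδ, hδΩ⟩ := hK.exists_cthickening_subset_open hΩ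
    (by rintro _ ⟨t, ht, rfl⟩; exact hx t ht)
  have hmem (t : ℂ) (ht : t ∈ Metric.sphere (0 : ℂ) r) (y : E) (hy : y ∈ Metric.ball x (δ / 2)) :
      Metric.closedBall (y + t • v) (δ / 2) ⊆ Ω := by
    intro z hz
    refine hδΩ (Metric.mem_cthickening_of_dist_le z (x + t • v) δ _ ⟨t, ht, rfl⟩ ?_)
    have h1 : dist (y + t • v) (x + t • v) < δ / 2 := by simpa using hy
    have h2 : dist z (y + t • v) ≤ δ / 2 := hz
    linarith [dist_triangle z (y + t • v) (x + t • v)]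
  have hc (θ : ℝ) : circleMap 0 r θ ∈ Metric.sphere (0 : ℂ) r := circleMap_mem_sphere 0 hr.le θ
  have hmem' (θ : ℝ) (y : E) (hy : y ∈ Metric.ball x (δ / 2)) : y + circleMap 0 r θ • v ∈ Ω :=
    hmem _ (hc θ) y hy (Metric.mem_closedBall_self (by positivity))
  let κ (θ : ℝ) : ℂ := deriv (circleMap 0 r) θ * (circleMap 0 r θ - 0)⁻¹
  have hκ : Continuous κ := by
    have h1 : Continuous fun θ : ℝ => (circleMap 0 r θ - 0)⁻¹ :=
      ((continuous_circleMap 0 r).sub continuous_const).inv₀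
        fun θ => by simp [circleMap_ne_center hr.ne']
    refine Continuous.mul ?_ h1
    have : deriv (circleMap 0 r) = fun θ => circleMap 0 r θ * Complex.I := by
      funext θ; simp
    rw [this]; fun_prop
  have hcont (y : E) (hy : y ∈ Metric.ball x (δ / 2)) :
      Continuous fun θ : ℝ => κ θ * G (y + circleMap 0 r θ • v) := by
    refine hκ.mul (continuous_iff_continuousAt.2 fun θ => ?_)
    have h1 : ContinuousAt G (y + circleMap 0 r θ • v) :=
      (hG.differentiableAt (hΩ.mem_nhds (hmem' θ y hy))).continuousAt
    have h2 : Continuous fun θ : ℝ => y + circleMap 0 r θ • v := by fun_prop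
    exact ContinuousAt.comp (f := fun θ : ℝ => y + circleMap 0 r θ • v) h1 h2.continuousAt
  have key := intervalIntegral.hasFDerivAt_integral_of_dominated_of_fderiv_le (𝕜 := ℂ)
    (μ := MeasureTheory.volume) (a := 0) (b := 2 * Real.pi) (x₀ := x) (s := Metric.ball x (δ / 2))
    (F := fun y θ => κ θ * G (y + circleMap 0 r θ • v))
    (F' := fun y θ => κ θ • fderiv ℂ G (y + circleMap 0 r θ • v))
    (bound := fun θ => ‖κ θ‖ * (C / (δ / 2)))
    (Metric.ball_mem_nhds x (by positivity)) ?_ ?_ ?_ ?_ ?_ ?_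
  · refine key.differentiableAt.congr_of_eventuallyEq (Eventually.of_forall fun y => ?_)
    simp only [circleIntegral, smul_eq_mul, κ, mul_assoc]
  · filter_upwards [Metric.ball_mem_nhds x (show 0 < δ / 2 by positivity)] with y hy
    exact (hcont y hy).aestronglyMeasurable
  · exact (hcont x (Metric.mem_ball_self (by positivity))).intervalIntegrable _ _
  · have h2 : Continuous fun θ : ℝ => x + circleMap 0 r θ • v := by fun_prop
    have : FiniteDimensional ℂ (E →L[ℂ] ℂ) := inferInstance
    have : SecondCountableTopology (E →L[ℂ] ℂ) :=
      have := FiniteDimensional.proper ℂ (E →L[ℂ] ℂ)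
      inferInstance
    exact (hκ.measurable.smul ((measurable_fderiv ℂ G).comp h2.measurable)).aestronglyMeasurable
  · refine Eventually.of_forall fun θ _ y hy => ?_
    rw [norm_smul]
    exact mul_le_mul_of_nonneg_left (norm_fderiv_le_of_bounded (by positivity) hΩ hG hC
      (hmem _ (hc θ) y hy)) (norm_nonneg _)
  · exact (hκ.norm.mul continuous_const).intervalIntegrable _ _
  · refine Eventually.of_forall fun θ _ y hy => ?_
    have h1 := (hG.differentiableAt (hΩ.mem_nhds (hmem' θ y hy))).hasFDerivAt
    have h2 : HasFDerivAt (fun y : E => y + circleMap 0 r θ • v) (ContinuousLinearMap.id ℂ E) y :=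
      (hasFDerivAt_id y).add_const _
    exact (h1.comp y h2).const_mul (κ θ)

/-- Riemann's extension theorem, as a division theorem: if `g = O(h)` near `x` and `h` does not
vanish identically near `x`, then `h` divides `g` near `x`. On a complex line through `x` on which
`h` does not vanish identically, the quotient is a Cauchy integral over a circle avoiding the zeros
of `h`; the same formula applies on the parallel lines. -/
theorem exists_div_of_bounded [FiniteDimensional ℂ E] {B : Set E} (hB : IsOpen B) {x : E}
    (hx : x ∈ B) {g h : E → ℂ} {C : ℝ} (hg : DifferentiableOn ℂ g B) (hh : DifferentiableOn ℂ h B)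
    (hb : ∀ y ∈ B, ‖g y‖ ≤ C * ‖h y‖) (hne : ∃ᶠ y in 𝓝 x, h y ≠ 0) :
    ∃ W ∈ 𝓝 x, ∃ F : E → ℂ, DifferentiableOn ℂ F W ∧ ∀ y ∈ W, F y * h y = g y := by
  obtain ⟨ε, hε, hεB⟩ := Metric.isOpen_iff.1 hB x hx
  obtain ⟨p, hpne, hp⟩ := (hne.and_eventually (Metric.ball_mem_nhds x hε)).exists
  set v := p - x with hv
  have hvε : ‖v‖ < ε := by simpa [hv, dist_eq_norm] using hp
  -- The zeros of `h` on the line through `x` and `p` are countable, so a small circle avoids them.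
  have hcount : {t | complexLine x p t ∈ Metric.ball x ε ∧
      h (complexLine x p t) = 0}.Countable := by
    have := countable_zeros_complexLine Metric.isOpen_ball (convex_ball x ε) (hh.mono hεB)
      (p := p) (q := x) hp hpne
    refine Set.Countable.mono ?_ (this.image fun t => 1 - t)
    refine fun t ht => ⟨1 - t, ?_, by ring⟩
    have : complexLine p x (1 - t) = complexLine x p t := by
      simp only [complexLine, sub_smul, one_smul, smul_sub]; abel
    simpa only [mem_ofPred_eq, this] using ht
  obtain ⟨r, ⟨hr0, hr1⟩, hrn⟩ := ((hcount.image fun t => ‖t‖).dense_compl ℝ).inter_open_nonempty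
    (Ioo 0 1) isOpen_Ioo (nonempty_Ioo.2 one_pos)
  have hball (t : ℂ) (ht : ‖t‖ ≤ 1) : x + t • v ∈ Metric.ball x ε := by
    rw [mem_ball_iff_norm, add_sub_cancel_left, norm_smul]
    exact (mul_le_of_le_one_left (norm_nonneg _) ht).trans_lt hvε
  have hxt (t : ℂ) (ht : t ∈ Metric.sphere (0 : ℂ) r) : h (x + t • v) ≠ 0 := by
    rw [mem_sphere_zero_iff_norm] at ht
    exact fun h0 => hrn ⟨t, ⟨hball t (by linarith), h0⟩, ht⟩
  let Ω : Set E := {y | y ∈ B ∧ h y ≠ 0}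
  have hΩ : IsOpen Ω := hh.continuousOn.isOpen_inter_preimage hB isOpen_ne
  let G (y : E) : ℂ := g y * (h y)⁻¹
  have hG : DifferentiableOn ℂ G Ω := fun y hy =>
    ((hg.differentiableAt (hB.mem_nhds hy.1)).mul ((hh.differentiableAt (hB.mem_nhds hy.1)).inv
      hy.2)).differentiableWithinAt
  have hGC (y) (hy : y ∈ Ω) : ‖G y‖ ≤ C := by
    simp only [G, ← div_eq_mul_inv, norm_div]
    rw [div_le_iff₀ (norm_pos_iff.2 hy.2)]
    exact hb y hy.1
  -- By compactness, for `y` near `x` the closed disc stays in `B` and the circle in `Ω`.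
  have hev1 : ∀ᶠ y in 𝓝 x, ∀ t ∈ Metric.sphere (0 : ℂ) r, y + t • v ∈ Ω := by
    refine (isCompact_sphere (0 : ℂ) r).eventually_forall_of_forall_eventually fun t ht => ?_
    have hc : Continuous fun z : E × ℂ => z.1 + z.2 • v := by fun_prop
    refine hc.continuousAt.eventually (hΩ.mem_nhds ⟨hεB (hball t ?_), hxt t ht⟩)
    rw [mem_sphere_zero_iff_norm] at ht
    linarith
  obtain ⟨η, hη, hηv⟩ : ∃ η > 0, η + ‖v‖ < ε := ⟨(ε - ‖v‖) / 2, by linarith, by linarith⟩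
  refine ⟨_, inter_mem hev1 (Metric.ball_mem_nhds x hη), fun y =>
    (2 * Real.pi * Complex.I)⁻¹ * ∮ t in C(0, r), (t - 0)⁻¹ • G (y + t • v), ?_, ?_⟩
  · intro y hy
    exact ((differentiableAt_circleIntegral hr0 hΩ hG hGC hy.1).const_mul _).differentiableWithinAt
  · rintro y ⟨hy, hyη⟩
    have hl (t : ℂ) (ht : t ∈ Metric.ball (0 : ℂ) 1) : y + t • v ∈ B := by
      refine hεB ?_
      rw [mem_ball_zero_iff] at ht
      rw [mem_ball_iff_norm] at hyη ⊢
      calc ‖y + t • v - x‖ = ‖(y - x) + t • v‖ := by congr 1; abel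
        _ ≤ ‖y - x‖ + ‖t‖ * ‖v‖ := (norm_add_le _ _).trans (by rw [norm_smul])
        _ ≤ ‖y - x‖ + 1 * ‖v‖ := by gcongr
        _ < ε := by linarith
    have hld : Differentiable ℂ fun t : ℂ => y + t • v := by fun_prop
    have := circleIntegral_div_mul_eq hr0 hr1 (g := fun t => g (y + t • v))
      (h := fun t => h (y + t • v)) (hg.comp hld.differentiableOn hl)
      (hh.comp hld.differentiableOn hl) (fun t ht => hb _ (hl t ht)) (fun t ht => (hy t ht).2)
    simpa only [zero_smul, add_zero, div_eq_mul_inv] using this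

end ConvexDomain

/-! ### The identity theorem and division on complex manifolds -/

section Manifolds
open Set Filter Topology
variable {E : Type*} [NormedAddCommGroup E] [NormedSpace ℂ E]
variable {M : Type*} [TopologicalSpace M] [ChartedSpace E M]

/-- Charts with convex target form a basis of neighbourhoods, and detect holomorphy. -/
theorem exists_convex_chart [IsManifold 𝓘(ℂ, E) ω M] {x : M} {W : Set M} (hW : W ∈ 𝓝 x) :
    ∃ e : OpenPartialHomeomorph M E, x ∈ e.source ∧ e.source ⊆ W ∧ Convex ℝ e.target ∧
      ∀ (f : M → ℂ), ∀ y ∈ e.source,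
        (MDifferentiableAt 𝓘(ℂ, E) 𝓘(ℂ, ℂ) f y ↔ DifferentiableAt ℂ (f ∘ e.symm) (e y)) := by
  let e₀ := chartAt E x
  have hx : x ∈ e₀.source := mem_chart_source E x
  have h1 : e₀.target ∩ e₀.symm ⁻¹' W ∈ 𝓝 (e₀ x) := by
    refine inter_mem (e₀.open_target.mem_nhds (e₀.map_source hx)) ?_
    exact (e₀.continuousAt_symm (e₀.map_source hx)).preimage_mem_nhds (by rwa [e₀.left_inv hx])
  obtain ⟨ε, hε, hB⟩ := Metric.mem_nhds_iff.1 h1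
  let e := (e₀.symm.restrOpen (Metric.ball (e₀ x) ε) Metric.isOpen_ball).symm
  have ht : e.target = Metric.ball (e₀ x) ε := inter_eq_right.2 fun y hy => (hB hy).1
  have hsub : ∀ y ∈ e.source, y ∈ e₀.source ∧ e₀ y ∈ Metric.ball (e₀ x) ε := by
    intro y hy
    have h2 : e y ∈ e.target := e.map_source hy
    rw [ht] at h2
    have h3 : e.symm (e y) = y := e.left_inv hy
    refine ⟨?_, h2⟩
    rw [← h3]
    exact e₀.map_target (hB h2).1
  refine ⟨e, ?_, ?_, ?_, ?_⟩
  · have h2 : e₀ x ∈ e.target := by rw [ht]; exact Metric.mem_ball_self hε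
    have h3 := e.map_target h2
    have h4 : e.symm (e₀ x) = x := e₀.left_inv hx
    rwa [h4] at h3
  · intro y hy
    have := (hB (hsub y hy).2).2
    rwa [mem_preimage, e₀.left_inv (hsub y hy).1] at this
  · rw [ht]; exact convex_ball _ _
  · intro f y hy
    have : IsManifold 𝓘(ℂ, E) 1 M := IsManifold.of_le (n := ω) le_top
    rw [mdifferentiableAt_iff_source_of_mem_source (x := x) (hsub y hy).1]
    simp only [mfld_simps, mdifferentiableWithinAt_univ]
    rw [mdifferentiableAt_iff_differentiableAt]
    rfl

theorem differentiableOn_comp_symm {e : OpenPartialHomeomorph M E}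
    (he : ∀ (f : M → ℂ), ∀ y ∈ e.source,
      (MDifferentiableAt 𝓘(ℂ, E) 𝓘(ℂ, ℂ) f y ↔ DifferentiableAt ℂ (f ∘ e.symm) (e y)))
    {f : M → ℂ} (hf : MDifferentiable 𝓘(ℂ, E) 𝓘(ℂ, ℂ) f) :
    DifferentiableOn ℂ (f ∘ e.symm) e.target := by
  intro y hy
  have := (he f _ (e.map_target hy)).1 (hf _)
  rw [e.right_inv hy] at this
  exact this.differentiableWithinAt

/-- If a holomorphic function on the domain of a convex chart vanishes near one point, it vanishes
identically. -/
theorem eqOn_zero_source {e : OpenPartialHomeomorph M E} (hc : Convex ℝ e.target)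
    (he : ∀ (f : M → ℂ), ∀ y ∈ e.source,
      (MDifferentiableAt 𝓘(ℂ, E) 𝓘(ℂ, ℂ) f y ↔ DifferentiableAt ℂ (f ∘ e.symm) (e y)))
    {f : M → ℂ} (hf : MDifferentiable 𝓘(ℂ, E) 𝓘(ℂ, ℂ) f) {p : M} (hp : p ∈ e.source)
    (h0 : ∀ᶠ y in 𝓝 p, f y = 0) : ∀ y ∈ e.source, f y = 0 := by
  intro y hy
  have h := eqOn_zero_of_convex e.open_target hc (differentiableOn_comp_symm he hf)
    (e.map_source hp) ?_ (e y) (e.map_source hy)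
  · simpa [e.left_inv hy] using h
  · have := e.continuousAt_symm (e.map_source hp)
    rw [ContinuousAt, e.left_inv hp] at this
    exact this.eventually h0

/-- The identity theorem for holomorphic functions on a connected complex manifold. -/
theorem eq_zero_of_eventually_eq_zero [IsManifold 𝓘(ℂ, E) ω M] [PreconnectedSpace M] {f : M → ℂ}
    (hf : MDifferentiable 𝓘(ℂ, E) 𝓘(ℂ, ℂ) f) {p : M} (h0 : ∀ᶠ y in 𝓝 p, f y = 0) : f = 0 := by
  have hclopen : IsClopen {x | ∀ᶠ y in 𝓝 x, f y = 0} := by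
    refine ⟨isClosed_of_closure_subset fun x hx => ?_, isOpen_setOfPred_eventually_nhds⟩
    obtain ⟨e, hxe, -, hc, he⟩ := exists_convex_chart (E := E) (univ_mem : univ ∈ 𝓝 x)
    obtain ⟨a, hae, ha⟩ := mem_closure_iff.1 hx e.source e.open_source hxe
    exact mem_of_superset (e.open_source.mem_nhds hxe) (eqOn_zero_source hc he hf hae ha)
  have := hclopen.eq_univ ⟨p, h0⟩
  funext x
  exact (this.symm ▸ mem_univ x : x ∈ {x | ∀ᶠ y in 𝓝 x, f y = 0}).self_of_nhds

theorem dense_ne_zero [IsManifold 𝓘(ℂ, E) ω M] [PreconnectedSpace M] {h : M → ℂ}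
    (hh : MDifferentiable 𝓘(ℂ, E) 𝓘(ℂ, ℂ) h) (h0 : h ≠ 0) : Dense {x | h x ≠ 0} := by
  intro x
  by_contra hx
  refine h0 (eq_zero_of_eventually_eq_zero hh (p := x) ?_)
  rw [mem_closure_iff_frequently, not_frequently] at hx
  exact hx.mono fun y hy => not_not.1 hy

/-- Global division: `h` divides `g` if `g` is locally bounded by a multiple of `h`. -/
theorem exists_mul_eq_of_locally_bounded [IsManifold 𝓘(ℂ, E) ω M] [FiniteDimensional ℂ E]
    {g h : M → ℂ}
    (hg : MDifferentiable 𝓘(ℂ, E) 𝓘(ℂ, ℂ) g) (hh : MDifferentiable 𝓘(ℂ, E) 𝓘(ℂ, ℂ) h)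
    (hd : Dense {x | h x ≠ 0}) (hb : ∀ x, ∃ C : ℝ, ∀ᶠ y in 𝓝 x, ‖g y‖ ≤ C * ‖h y‖) :
    ∃ F : M → ℂ, MDifferentiable 𝓘(ℂ, E) 𝓘(ℂ, ℂ) F ∧ ∀ x, F x * h x = g x := by
  have hloc (x : M) : ∃ (O : Set M) (G : M → ℂ), IsOpen O ∧ x ∈ O ∧
      (∀ y ∈ O, MDifferentiableAt 𝓘(ℂ, E) 𝓘(ℂ, ℂ) G y) ∧ ∀ y ∈ O, G y * h y = g y := by
    obtain ⟨C, hC⟩ := hb x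
    obtain ⟨e, hxe, heW, -, he⟩ := exists_convex_chart (E := E) hC
    have hfr : ∃ᶠ y in 𝓝 (e x), (h ∘ e.symm) y ≠ 0 := by
      have h1 : ∃ᶠ y in 𝓝 x, h y ≠ 0 := mem_closure_iff_frequently.1 (hd x)
      have h2 := h1.and_eventually (e.open_source.mem_nhds hxe)
      refine (e.continuousAt hxe).frequently (h2.mono fun y hy => ?_)
      simpa [e.left_inv hy.2] using hy.1
    obtain ⟨W, hW, F, hF, hFg⟩ := exists_div_of_bounded e.open_target (e.map_source hxe)
      (differentiableOn_comp_symm he hg) (differentiableOn_comp_symm he hh)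
      (fun y hy => heW (e.map_target hy)) hfr
    refine ⟨e.source ∩ e ⁻¹' interior W, F ∘ e, e.isOpen_inter_preimage isOpen_interior,
      ⟨hxe, mem_interior_iff_mem_nhds.2 hW⟩, fun y hy => ?_, fun y hy => ?_⟩
    · rw [he _ y hy.1]
      have h1 : DifferentiableAt ℂ F (e y) :=
        hF.differentiableAt (mem_interior_iff_mem_nhds.1 hy.2)
      refine h1.congr_of_eventuallyEq ?_
      filter_upwards [e.open_target.mem_nhds (e.map_source hy.1)] with z hz
      simp [e.right_inv hz]
    · have := hFg (e y) (interior_subset hy.2)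
      simpa [e.left_inv hy.1] using this
  choose O G hO hxO hGd hGg using hloc
  -- Local quotients agree where `h ≠ 0`, hence everywhere by density.
  have hagree (x y : M) (hy : y ∈ O x) : G y y = G x y := by
    have hfr : ∃ᶠ z in 𝓝 y, G y z = G x z := by
      refine ((mem_closure_iff_frequently.1 (hd y)).and_eventually
        (inter_mem ((hO x).mem_nhds hy) ((hO y).mem_nhds (hxO y)))).mono ?_
      rintro z ⟨hz, hzx, hzy⟩
      exact mul_right_cancel₀ hz ((hGg y z hzy).trans (hGg x z hzx).symm)
    by_contra hne
    have hsub := (hGd y y (hxO y)).continuousAt.sub (hGd x y hy).continuousAt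
    exact hfr ((hsub.eventually_ne (sub_ne_zero.2 hne)).mono fun z hz => sub_ne_zero.1 hz)
  refine ⟨fun x => G x x, fun x => ?_, fun x => hGg x x (hxO x)⟩
  refine (hGd x x (hxO x)).congr_of_eventuallyEq ?_
  filter_upwards [(hO x).mem_nhds (hxO x)] with y hy
  exact hagree x y hy

end Manifolds

/-! ### Complements of analytic subsets -/

section Analytic
open Set Filter Topology
variable {E : Type*} [NormedAddCommGroup E] [NormedSpace ℂ E]
variable {M : Type} [TopologicalSpace M] [ChartedSpace E M] [IsManifold 𝓘(ℂ, E) ω M]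

/-- Charts with convex domain on which `Z` is given by holomorphic equations. -/
theorem exists_analytic_chart {Z : Set M} (hZ : IsAnalyticSubset E Z) {x : M} {W : Set M}
    (hW : W ∈ 𝓝 x) :
    ∃ (U : Opens M) (e : OpenPartialHomeomorph U E) (k : ℕ) (f : Fin k → U → ℂ)
      (hx : x ∈ U), (⟨x, hx⟩ : U) ∈ e.source ∧ (∀ y ∈ e.source, (y : M) ∈ W) ∧
      Convex ℝ e.target ∧
      (∀ (f : U → ℂ), ∀ y ∈ e.source,
        (MDifferentiableAt 𝓘(ℂ, E) 𝓘(ℂ, ℂ) f y ↔ DifferentiableAt ℂ (f ∘ e.symm) (e y))) ∧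
      (∀ i, MDifferentiable 𝓘(ℂ, E) 𝓘(ℂ, ℂ) (f i)) ∧ ∀ y : U, (y : M) ∈ Z ↔ ∀ i, f i y = 0 := by
  obtain ⟨U, hx, k, f, hf⟩ := hZ x
  have hW' : (Subtype.val ⁻¹' W : Set U) ∈ 𝓝 (⟨x, hx⟩ : U) :=
    continuous_subtype_val.continuousAt.preimage_mem_nhds hW
  obtain ⟨e, hxe, heW, hc, he⟩ := exists_convex_chart (E := E) hW'
  exact ⟨U, e, k, fun i => (f i).1, hx, hxe, heW, hc, he, fun i => (f i).2, hf⟩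

/-- A proper analytic subset of a connected complex manifold is nowhere dense. -/
theorem interior_eq_empty_of_isAnalyticSubset [PreconnectedSpace M] {Z : Set M}
    (hZ : IsAnalyticSubset E Z) (hne : Z ≠ univ) : interior Z = ∅ := by
  have hclopen : IsClopen (interior Z) := by
    refine ⟨isClosed_of_closure_subset fun x hx => ?_, isOpen_interior⟩
    obtain ⟨U, e, k, f, hxU, hxe, -, hc, he, hf, hfZ⟩ := exists_analytic_chart hZ (x := x) univ_mem
    have ho : IsOpen (Subtype.val '' e.source : Set M) :=
      U.isOpen.isOpenMap_subtype_val _ e.open_source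
    obtain ⟨_, ⟨a, hae, rfl⟩, ha⟩ := mem_closure_iff.1 hx _ ho ⟨_, hxe, rfl⟩
    refine mem_interior.2 ⟨_, ?_, ho, ⟨_, hxe, rfl⟩⟩
    rintro _ ⟨y, hy, rfl⟩
    refine (hfZ y).2 fun i => eqOn_zero_source hc he (hf i) hae ?_ y hy
    filter_upwards [continuous_subtype_val.continuousAt.preimage_mem_nhds
      (isOpen_interior.mem_nhds ha)] with z hz
    exact (hfZ z).1 (interior_subset hz) i
  exact (isClopen_iff.1 hclopen).resolve_right fun h => hne (interior_eq_univ.1 h)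

/-- Every point has arbitrarily small open neighbourhoods in which the complement of an analytic
subset is connected. -/
theorem exists_isPreconnected_diff {Z : Set M} (hZ : IsAnalyticSubset E Z) {x : M} {W : Set M}
    (hW : W ∈ 𝓝 x) : ∃ V : Set M, IsOpen V ∧ x ∈ V ∧ V ⊆ W ∧ IsPreconnected (V \ Z) := by
  obtain ⟨U, e, k, f, hxU, hxe, heW, hc, he, hf, hfZ⟩ := exists_analytic_chart hZ hW
  refine ⟨Subtype.val '' e.source, U.isOpen.isOpenMap_subtype_val _ e.open_source, ⟨_, hxe, rfl⟩,
    by rintro _ ⟨y, hy, rfl⟩; exact heW y hy, ?_⟩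
  have h := isPreconnected_convex_diff (Z := {y | (e.symm y : M) ∈ Z}) e.open_target hc ?_
  · have heq : Subtype.val '' e.source \ Z =
        (fun y => (e.symm y : M)) '' (e.target \ {y | (e.symm y : M) ∈ Z}) := by
      ext z
      constructor
      · rintro ⟨⟨y, hy, rfl⟩, hyZ⟩
        refine ⟨e y, ⟨e.map_source hy, ?_⟩, ?_⟩
        · simpa [e.left_inv hy] using hyZ
        · simp [e.left_inv hy]
      · rintro ⟨y, ⟨hy, hyZ⟩, rfl⟩
        exact ⟨⟨_, e.map_target hy, rfl⟩, hyZ⟩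
    rw [heq]
    refine h.image _ (continuous_subtype_val.comp_continuousOn ?_)
    exact e.continuousOn_symm.mono sdiff_subset
  · rintro p ⟨hp, hpZ⟩
    have hpZ : ¬ (e.symm p : M) ∈ Z := hpZ
    rw [hfZ, not_forall] at hpZ
    obtain ⟨i, hi⟩ := hpZ
    exact ⟨f i ∘ e.symm, differentiableOn_comp_symm he (hf i), hi,
      fun y hy => (hfZ _).1 hy.2 i⟩

/-- A nowhere dense set whose complement is locally connected in `M` does not disconnect any
connected open set. -/
theorem isPreconnected_diff_of_locally {M : Type*} [TopologicalSpace M] {Z W : Set M}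
    (hZ : ∀ x : M, ∀ W ∈ 𝓝 x, ∃ V : Set M, IsOpen V ∧ x ∈ V ∧ V ⊆ W ∧ IsPreconnected (V \ Z))
    (hZi : interior Z = ∅) (hWo : IsOpen W) (hW : IsPreconnected W) : IsPreconnected (W \ Z) := by
  have hmeet (V : Set M) (hV : IsOpen V) (hne : V.Nonempty) : (V \ Z).Nonempty := by
    by_contra h
    rw [not_nonempty_iff_eq_empty, sdiff_eq_empty] at h
    exact hne.ne_empty (subset_empty_iff.1 (hZi ▸ interior_maximal h hV))
  rw [isPreconnected_iff_subset_of_disjoint]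
  intro u v hu hv huv hdis
  -- The points of `W` near which `W \ Z` lies in `u` form an open set, and those for `u` and `v`
  -- partition `W`.
  let A (u : Set M) : Set M := ⋃₀ {V | IsOpen V ∧ V ⊆ W ∧ V \ Z ⊆ u}
  have hA (u : Set M) : IsOpen (A u) := isOpen_sUnion fun V hV => hV.1
  have hcov : W ⊆ A u ∪ A v := by
    intro x hx
    obtain ⟨V, hVo, hxV, hVW, hVc⟩ := hZ x W (hWo.mem_nhds hx)
    rw [isPreconnected_iff_subset_of_disjoint] at hVc
    have hsub : V \ Z ⊆ W \ Z := sdiff_subset_sdiff_left hVW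
    rcases hVc u v hu hv (hsub.trans huv) (subset_empty_iff.1
      ((inter_subset_inter_left _ hsub).trans hdis.subset)) with h | h
    · exact Or.inl ⟨V, ⟨hVo, hVW, h⟩, hxV⟩
    · exact Or.inr ⟨V, ⟨hVo, hVW, h⟩, hxV⟩
  have hAW (u : Set M) : (A u ∩ W) \ Z ⊆ u := by
    rintro x ⟨⟨⟨V, hV, hxV⟩, -⟩, hxZ⟩
    exact hV.2.2 ⟨hxV, hxZ⟩
  have hAA : W ∩ (A u ∩ A v) = ∅ := by
    by_contra hne
    obtain ⟨x, ⟨hxW, hxu, hxv⟩, hxZ⟩ := hmeet _ (hWo.inter ((hA u).inter (hA v)))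
      (nonempty_iff_ne_empty.2 hne)
    have : x ∈ W \ Z ∩ (u ∩ v) := ⟨⟨hxW, hxZ⟩, hAW u ⟨⟨hxu, hxW⟩, hxZ⟩, hAW v ⟨⟨hxv, hxW⟩, hxZ⟩⟩
    rw [hdis] at this
    exact this
  rw [isPreconnected_iff_subset_of_disjoint] at hW
  rcases hW _ _ (hA u) (hA v) hcov hAA with h | h
  · exact Or.inl fun x hx => hAW u ⟨⟨h hx.1, hx.1⟩, hx.2⟩
  · exact Or.inr fun x hx => hAW v ⟨⟨h hx.1, hx.1⟩, hx.2⟩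

/-- A proper analytic subset of a connected manifold does not disconnect connected open sets. -/
theorem isConnected_diff_of_isAnalyticSubset [PreconnectedSpace M] {Z W : Set M}
    (hZ : IsAnalyticSubset E Z) (hne : Z ≠ univ) (hWo : IsOpen W) (hW : _root_.IsConnected W) :
    _root_.IsConnected (W \ Z) := by
  have hi := interior_eq_empty_of_isAnalyticSubset hZ hne
  refine ⟨?_, isPreconnected_diff_of_locally (fun x W hW => exists_isPreconnected_diff hZ hW) hi hWo
    hW.isPreconnected⟩
  by_contra h
  rw [not_nonempty_iff_eq_empty, sdiff_eq_empty] at h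
  exact hW.nonempty.ne_empty (subset_empty_iff.1 (hi ▸ interior_maximal h hWo))

end Analytic

/-! ### Extension of holomorphic functions by a finiteness argument -/

section Algebra
open Polynomial

/-- If `A ≤ B` are subalgebras and `φ` is a linear map from `B` to a finite-dimensional space whose
kernel lies in `A`, then every `f` in `B` satisfies a polynomial relation over `A`, and is
either a quotient of two elements of `A` or algebraic over the ground field. -/
theorem polynomial_and_quotient_of_finite_quotient {k R H : Type*} [Field k] [CommRing R]
    [Algebra k R] [AddCommGroup H] [Module k H] [Module.Finite k H] (A B : Subalgebra k R)
    (hAB : A ≤ B) (φ : Subalgebra.toSubmodule B →ₗ[k] H) (hφ : ∀ b, φ b = 0 → (b : R) ∈ A)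
    {f : R} (hf : f ∈ B) :
    (∃ P : k[X], 0 < P.degree ∧ aeval f P ∈ A) ∧
      ((∃ h ∈ A, h ≠ 0 ∧ h * f ∈ A) ∨ ∃ P : k[X], P ≠ 0 ∧ aeval f P = 0) := by
  have haeval (P : k[X]) : aeval f P ∈ B := by
    have := (aeval (⟨f, hf⟩ : B) P).2
    rwa [← Subalgebra.aeval_coe] at this
  let ev : k[X] →ₗ[k] Subalgebra.toSubmodule B :=
    (aeval f).toLinearMap.codRestrict _ haeval
  have hinf : ¬ Module.Finite k k[X] := Polynomial.not_finite
  constructor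
  · -- Multiplying by `X` makes the degree of the relation positive.
    let ψ : k[X] →ₗ[k] H := φ ∘ₗ ev ∘ₗ LinearMap.mulLeft k X
    have hψ : ¬ Function.Injective ψ := fun h => hinf (Module.Finite.of_injective ψ h)
    rw [← LinearMap.ker_eq_bot, Submodule.eq_bot_iff] at hψ
    push Not at hψ
    obtain ⟨Q, hQ, hQ0⟩ := hψ
    refine ⟨X * Q, ?_, hφ _ hQ⟩
    rw [degree_mul, degree_X]
    have := zero_le_degree_iff.2 hQ0
    exact lt_of_lt_of_le (by norm_num) (add_le_add le_rfl this)
  · let μ : Subalgebra.toSubmodule A →ₗ[k] H := φ ∘ₗ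
      ((LinearMap.mulRight k f).restrict fun a ha => B.mul_mem (hAB ha) hf)
    by_cases hμ : Function.Injective μ
    · right
      have hA : Module.Finite k (Subalgebra.toSubmodule A) := Module.Finite.of_injective μ hμ
      let ψ : k[X] →ₗ[k] H := φ ∘ₗ ev
      have hB : ¬ Function.Injective ev := by
        intro hev
        -- The kernel of `ψ` embeds into `A` and its image into `H`.
        let κ : LinearMap.ker ψ →ₗ[k] Subalgebra.toSubmodule A :=
          ((aeval f).toLinearMap ∘ₗ (LinearMap.ker ψ).subtype).codRestrict _
            fun P => hφ _ P.2
        have hκ : Function.Injective κ := fun P Q h =>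
          Subtype.ext (hev (Subtype.ext
            (congrArg (fun a : Subalgebra.toSubmodule A => (a : R)) h)))
        have h1 : Module.Finite k (LinearMap.ker ψ) := Module.Finite.of_injective κ hκ
        have h2 : Module.Finite k (LinearMap.range ψ) := inferInstance
        have h3 : Module.Finite k (k[X] ⧸ LinearMap.ker ψ) :=
          Module.Finite.equiv ψ.quotKerEquivRange.symm
        exact hinf (Module.Finite.of_submodule_quotient (LinearMap.ker ψ))
      rw [← LinearMap.ker_eq_bot, Submodule.eq_bot_iff] at hB
      push Not at hB
      obtain ⟨P, hP, hP0⟩ := hB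
      exact ⟨P, hP0, congrArg Subtype.val hP⟩
    · left
      rw [← LinearMap.ker_eq_bot, Submodule.eq_bot_iff] at hμ
      push Not at hμ
      obtain ⟨h, hh, hh0⟩ := hμ
      exact ⟨h, h.2, fun h0 => hh0 (Subtype.ext h0), hφ _ hh⟩

end Algebra

section Extension
open Set Filter Topology Polynomial
variable (E : Type*) [NormedAddCommGroup E] [NormedSpace ℂ E]
variable (N : Type*) [TopologicalSpace N] [ChartedSpace E N]

/-- The algebra of holomorphic functions on a complex manifold. -/
def holomorphicAlgebra : Subalgebra ℂ (N → ℂ) where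
  carrier := {f | MDifferentiable 𝓘(ℂ, E) 𝓘(ℂ, ℂ) f}
  mul_mem' hf hg := MDifferentiable.mul hf hg
  add_mem' hf hg := MDifferentiable.add hf hg
  algebraMap_mem' _ := mdifferentiable_const

variable {E N}

theorem mdifferentiable_comp_val {f : N → ℂ} (hf : MDifferentiable 𝓘(ℂ, E) 𝓘(ℂ, ℂ) f)
    (U : Opens N) : MDifferentiable 𝓘(ℂ, E) 𝓘(ℂ, ℂ) (fun y : U => f y) :=
  hf.comp ((contMDiff_subtype_val (n := 1)).mdifferentiable one_ne_zero)

theorem mdifferentiable_of_comp_val {f : N → ℂ}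
    (hf : MDifferentiable 𝓘(ℂ, E) 𝓘(ℂ, ℂ) (fun y : (⊤ : Opens N) => f y)) :
    MDifferentiable 𝓘(ℂ, E) 𝓘(ℂ, ℂ) f := fun x =>
  (differentiableWithinAt_localInvariantProp.liftPropAt_iff_comp_subtype_val
    (U := ⊤) f ⟨x, trivial⟩).2 (hf ⟨x, trivial⟩)

/-- A holomorphic function on a connected manifold which is algebraic over `ℂ` is constant. -/
theorem exists_const_of_aeval_eq_zero [PreconnectedSpace N] {f : N → ℂ} (hf : Continuous f)
    {P : ℂ[X]} (hP : P ≠ 0) (h : aeval f P = 0) (x y : N) : f x = f y := by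
  have hsub : range f ⊆ {z | P.IsRoot z} := by
    rintro _ ⟨z, rfl⟩
    have := congrFun h z
    rw [Polynomial.aeval_fn_apply] at this
    simpa [Polynomial.coe_aeval_eq_eval] using this
  have hfin : (range f).Finite := (Polynomial.finite_setOfPred_isRoot hP).subset hsub
  exact hfin.countable.isTotallyDisconnected _ subset_rfl (isPreconnected_range hf)
    ⟨x, rfl⟩ ⟨y, rfl⟩

theorem exists_bound_of_eval_bounded {P : ℂ[X]} (hP : 0 < P.degree) (Q : ℝ) :
    ∃ C : ℝ, ∀ z : ℂ, ‖P.eval z‖ ≤ Q → ‖z‖ ≤ C := by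
  have h := (P.tendsto_norm_atTop hP tendsto_norm_cobounded_atTop).eventually_gt_atTop Q
  rw [← comap_norm_atTop, eventually_comap] at h
  obtain ⟨C, hC⟩ := h.exists_forall_of_atTop
  refine ⟨C, fun z hz => ?_⟩
  by_contra hlt
  exact (hC _ (not_le.1 hlt).le z rfl).not_ge hz

/-- If `h f = g` and `P(f) = q` hold on a nonempty open subset, with `g`, `h` and `q` holomorphic on
the connected manifold `N`, then `g / h` is holomorphic on `N`: it satisfies `P(g / h) = q` wherever
`h ≠ 0`, so it is locally bounded. -/
theorem exists_extension_of_quotient [IsManifold 𝓘(ℂ, E) ω N] [FiniteDimensional ℂ E]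
    [PreconnectedSpace N] {U : Opens N} [Nonempty U] {f : U → ℂ} {g h q : N → ℂ}
    (hg : g ∈ holomorphicAlgebra E N) (hh : h ∈ holomorphicAlgebra E N)
    (hq : q ∈ holomorphicAlgebra E N) (h0 : h ≠ 0) {P : ℂ[X]} (hP : 0 < P.degree)
    (hgf : ∀ y : U, h y * f y = g y) (hPq : ∀ y : U, P.eval (f y) = q y) :
    ∃ F : N → ℂ, MDifferentiable 𝓘(ℂ, E) 𝓘(ℂ, ℂ) F ∧ ∀ x, F x * h x = g x := by
  -- Clearing denominators in `P(g / h) = q` gives a holomorphic identity valid on all of `N`.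
  let D : N → ℂ := (∑ i ∈ Finset.range (P.natDegree + 1),
    P.coeff i • (g ^ i * h ^ (P.natDegree - i))) - h ^ P.natDegree * q
  have hD : D ∈ holomorphicAlgebra E N :=
    sub_mem (sum_mem fun i _ => Subalgebra.smul_mem _ (mul_mem (pow_mem hg _) (pow_mem hh _)) _)
      (mul_mem (pow_mem hh _) hq)
  have hDx (x : N) (z : ℂ) (hz : g x = h x * z) :
      D x = h x ^ P.natDegree * (P.eval z - q x) := by
    simp only [D, Pi.sub_apply, Finset.sum_apply, Pi.smul_apply, Pi.mul_apply, Pi.pow_apply, hz,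
      smul_eq_mul]
    rw [Polynomial.eval_eq_sum_range, mul_sub, Finset.mul_sum]
    congr 1
    refine Finset.sum_congr rfl fun i hi => ?_
    have hi : i ≤ P.natDegree := Nat.lt_succ_iff.1 (Finset.mem_range.1 hi)
    rw [mul_pow]
    rw [← pow_mul_pow_sub (h x) hi]; ring
  obtain ⟨p⟩ := ‹Nonempty U›
  have hD0 : D = 0 := by
    refine eq_zero_of_eventually_eq_zero hD (p := p) ?_
    filter_upwards [U.isOpen.mem_nhds p.2] with y hy
    rw [hDx y (f ⟨y, hy⟩) (hgf ⟨y, hy⟩).symm, hPq ⟨y, hy⟩, sub_self, mul_zero]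
  have hd := dense_ne_zero hh h0
  refine exists_mul_eq_of_locally_bounded hg hh hd fun x => ?_
  have hgc : Continuous g := MDifferentiable.continuous hg
  have hhc : Continuous h := MDifferentiable.continuous hh
  have hqc : Continuous q := MDifferentiable.continuous hq
  obtain ⟨C, hC⟩ := exists_bound_of_eval_bounded hP (‖q x‖ + 1)
  have hO : IsOpen {y | ‖q y‖ < ‖q x‖ + 1} := isOpen_lt hqc.norm continuous_const
  refine ⟨C, ?_⟩
  filter_upwards [hO.mem_nhds (show ‖q x‖ < ‖q x‖ + 1 by linarith)] with y hy
  have hcl : IsClosed {z | ‖g z‖ ≤ C * ‖h z‖} :=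
    isClosed_le hgc.norm (continuous_const.mul hhc.norm)
  refine hcl.closure_subset_iff.2 ?_ (hd.open_subset_closure_inter hO hy)
  rintro z ⟨hzq, hz⟩
  have hz' : g z = h z * (g z / h z) := (mul_div_cancel₀ (g z) hz).symm
  have h1 := hDx z _ hz'
  rw [hD0, Pi.zero_apply, eq_comm, mul_eq_zero, sub_eq_zero] at h1
  have h2 := h1.resolve_left (pow_ne_zero _ hz)
  have h3 := hC (g z / h z) (by rw [h2]; exact le_of_lt hzq)
  rwa [norm_div, div_le_iff₀ (norm_pos_iff.2 hz)] at h3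

/-- If the holomorphic functions on `U` which do not extend to the connected manifold `N` are
detected by a linear map to a finite-dimensional vector space, then every holomorphic function on
the connected open set `U` extends to `N`. -/
theorem exists_extension_of_finite [IsManifold 𝓘(ℂ, E) ω N] [FiniteDimensional ℂ E]
    [PreconnectedSpace N] {U : Opens N} [ConnectedSpace U]
    {H : Type*} [AddCommGroup H] [Module ℂ H] [Module.Finite ℂ H]
    (φ : Subalgebra.toSubmodule (holomorphicAlgebra E U) →ₗ[ℂ] H)
    (hφ : ∀ f, φ f = 0 → ∃ F ∈ holomorphicAlgebra E N, ∀ y : U, F y = f.1 y)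
    {f : U → ℂ} (hf : f ∈ holomorphicAlgebra E U) :
    ∃ F ∈ holomorphicAlgebra E N, ∀ y : U, F y = f y := by
  let ρ : (N → ℂ) →ₐ[ℂ] (U → ℂ) :=
    { toFun := fun F y => F y
      map_one' := rfl
      map_mul' := fun _ _ => rfl
      map_zero' := rfl
      map_add' := fun _ _ => rfl
      commutes' := fun _ => rfl }
  let A : Subalgebra ℂ (U → ℂ) := (holomorphicAlgebra E N).map ρ
  have hAB : A ≤ holomorphicAlgebra E U := by
    rintro _ ⟨F, hF, rfl⟩
    exact mdifferentiable_comp_val hF U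
  obtain ⟨⟨P, hP, q, hq, hqP⟩, hcase⟩ := polynomial_and_quotient_of_finite_quotient A
    (holomorphicAlgebra E U) hAB φ
    (fun b hb => by obtain ⟨F, hF, h⟩ := hφ b hb; exact ⟨F, hF, funext h⟩) hf
  rcases hcase with ⟨_, ⟨h, hh, rfl⟩, h0, g, hg, hgf⟩ | ⟨P, hP, hPf⟩
  · have hgf' (y : U) : h y * f y = g y := (congrFun hgf y).symm
    have hPq (y : U) : P.eval (f y) = q y := by
      have := congrFun hqP y
      rw [Polynomial.aeval_fn_apply, Polynomial.coe_aeval_eq_eval] at this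
      exact this.symm
    obtain ⟨F, hF, hFh⟩ := exists_extension_of_quotient hg hh hq
      (fun h1 => h0 (by rw [h1]; rfl)) hP hgf' hPq
    refine ⟨F, hF, fun y => congrFun (Continuous.ext_on
      (dense_ne_zero (mdifferentiable_comp_val hh U) h0)
      (mdifferentiable_comp_val hF U).continuous (MDifferentiable.continuous hf) ?_) y⟩
    intro z hz
    refine mul_right_cancel₀ (b := h z) hz ?_
    change F z * h z = f z * h z
    rw [hFh, ← hgf', mul_comm]
  · obtain ⟨p⟩ := (inferInstance : Nonempty U)
    exact ⟨fun _ => f p, mdifferentiable_const, fun y =>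
      exists_const_of_aeval_eq_zero (MDifferentiable.continuous hf) hP hPf p y⟩

end Extension

/-! ### The Hartogs property -/

section Criterion
variable {E : Type*} [NormedAddCommGroup E] [NormedSpace ℂ E]
variable {M : Type} [TopologicalSpace M] [ChartedSpace E M] [IsManifold 𝓘(ℂ, E) ω M]

/-- A function on `U` and a global function which agree on a nonempty open subset of the connected
open set `U` agree on `U`. -/
theorem eqOn_of_eqOn_inf {U V : Opens M} [PreconnectedSpace U] (hne : (U ⊓ V : Opens M) ≠ ⊥)
    {f : U → ℂ} {g : M → ℂ} (hf : MDifferentiable 𝓘(ℂ, E) 𝓘(ℂ, ℂ) f)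
    (hg : MDifferentiable 𝓘(ℂ, E) 𝓘(ℂ, ℂ) g) (h : ∀ y : U, (y : M) ∈ V → g y = f y) (y : U) :
    g y = f y := by
  obtain ⟨p, hpU, hpV⟩ := (Opens.ne_bot_iff_nonempty _).1 hne
  have hd : (fun y : U => g y - f y) = 0 := by
    refine eq_zero_of_eventually_eq_zero ((mdifferentiable_comp_val hg U).sub hf) (p := ⟨p, hpU⟩) ?_
    filter_upwards [(V.isOpen.preimage continuous_subtype_val).mem_nhds
      (show p ∈ V from hpV)] with z hz
    exact sub_eq_zero.2 (h z hz)
  exact sub_eq_zero.1 (congrFun hd y)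

/-- A connected non-compact complex manifold with finite-dimensional `H¹_c(M, 𝒪)` is Hartogs. -/
theorem isHartogs_of_finite [FiniteDimensional ℂ E] [PreconnectedSpace M] [NoncompactSpace M]
    [Module.Finite ℂ (compactCohomology 1 (holomorphicSheaf E M))] : IsHartogs E M := by
  intro U hU hUc
  have : ConnectedSpace U := isConnected_iff_connectedSpace.1 hUc
  have hmeet (V : Opens M) (hV : IsCompact ((V : Set M)ᶜ)) : (U ⊓ V : Opens M) ≠ ⊥ := by
    intro h
    refine noncompact_univ M ?_
    have h2 : ((U : Set M)ᶜ ∪ (V : Set M)ᶜ) = Set.univ := by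
      rw [← Set.compl_inter, Set.compl_univ_iff]
      exact congrArg (fun W : Opens M => (W : Set M)) h
    exact h2 ▸ hU.union hV
  have hglob (F : holomorphicFunctions E M ⊤) :
      MDifferentiable 𝓘(ℂ, E) 𝓘(ℂ, ℂ) (fun x : M => F.1 ⟨x, trivial⟩) :=
    mdifferentiable_of_comp_val F.2
  obtain ⟨φ, hφ⟩ := exists_lift_to_compactCohomology (holomorphicSheaf E M) U hU
  have hlift (f : holomorphicFunctions E M U) (hf : φ f = 0) :
      ∃ F ∈ holomorphicAlgebra E M, ∀ y : U, F y = f.1 y := by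
    obtain ⟨V, g, hV, h⟩ := hφ f hf
    refine ⟨fun x => (g : holomorphicFunctions E M ⊤).1 ⟨x, trivial⟩, hglob g, ?_⟩
    refine eqOn_of_eqOn_inf (hmeet V hV) f.2 (hglob g) fun y hy => ?_
    exact (congrFun (congrArg (Subtype.val (p := (· ∈ holomorphicFunctions E M (U ⊓ V)))) h)
      ⟨y.1, y.2, hy⟩).symm
  constructor
  · refine (injective_iff_map_eq_zero _).2 fun F hF => ?_
    obtain ⟨⟨p, hp⟩⟩ := (inferInstance : Nonempty U)
    have h0 : (fun x : M => (F : holomorphicFunctions E M ⊤).1 ⟨x, trivial⟩) = 0 := by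
      refine eq_zero_of_eventually_eq_zero (hglob F) (p := p) ?_
      filter_upwards [U.isOpen.mem_nhds hp] with y hy
      exact congrFun (congrArg (Subtype.val (p := (· ∈ holomorphicFunctions E M U))) hF) ⟨y, hy⟩
    exact Subtype.ext (funext fun x => congrFun h0 x.1)
  · intro f
    obtain ⟨F, hF, h⟩ := exists_extension_of_finite (E := E) (N := M)
      (H := compactCohomology 1 (holomorphicSheaf E M)) φ hlift
      (f : holomorphicFunctions E M U).2
    exact ⟨(⟨fun x => F x.1, mdifferentiable_comp_val hF ⊤⟩ : holomorphicFunctions E M ⊤),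
      Subtype.ext (funext h)⟩

end Criterion

section Surjectivity
variable {Y : Type} [TopologicalSpace Y] (Z : Closeds Y)
  (F : TopCat.Sheaf (ModuleCat.{0} ℂ) (TopCat.of Y))

/-- A section of `F` near `Z` whose restriction to the complement `X` of `Z` extends to `X`
extends to a global section. -/
theorem exists_global_section_of_extension {X V : Opens Y} (hX : X = Z.compl)
    (hV : (Z : Set Y) ⊆ V) (a : F.presheaf.obj (op V))
    (c : (inverseImage (inclusionMap X) F).presheaf.obj (op ⊤))
    (hc : res (inverseImage (inclusionMap X) F).presheaf le_top c =
      unitOn (inclusionMap X) F V a) :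
    ∃ s : F.presheaf.obj (op ⊤), res F.presheaf le_top s = a := by
  obtain ⟨g, hg⟩ := (unitOn_bijective_of_le X F le_rfl).2
    (res (inverseImage (inclusionMap X) F).presheaf le_top c)
  change unitOn (inclusionMap X) F X g = _ at hg
  have h0 : res F.presheaf (inf_le_left : X ⊓ V ≤ X) g =
      res F.presheaf (inf_le_right : X ⊓ V ≤ V) a := by
    refine unitOn_injective_of_le X F inf_le_left ?_
    rw [unitOn_res, unitOn_res, hg, ← hc]
    exact (res_res _ _ _ _).trans (res_res _ _ _ _).symm
  obtain ⟨s, hs⟩ := exists_gluing F (fun b : Bool => if b then X else V) ⊤ (fun _ => le_top)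
    (fun x _ => Opens.mem_iSup.2 <| (mem_or_mem_of_subset Z hX hV x).elim
      (fun h => ⟨true, h⟩) (fun h => ⟨false, h⟩))
    (fun b => match b with | true => g | false => a) (by
      rintro (_ | _) (_ | _)
      · rfl
      · have h1 := congrArg (res F.presheaf (le_inf inf_le_right inf_le_left : V ⊓ X ≤ X ⊓ V)) h0
        exact ((res_res _ _ _ _).symm.trans h1.symm).trans (res_res _ _ _ _)
      · exact h0
      · rfl)
  exact ⟨s, hs false⟩

end Surjectivity

section Main
variable {E : Type*} [NormedAddCommGroup E] [NormedSpace ℂ E]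
variable {Y : Type} [TopologicalSpace Y] [T2Space Y] [CompactSpace Y] [ConnectedSpace Y]
  [ChartedSpace E Y] [IsManifold 𝓘(ℂ, E) ω Y]

/-- Every section of `j⁻¹ F` extends to a section of `F` on a connected neighbourhood `U` of `Z`.
If `X` is Hartogs, the corresponding holomorphic function on the connected set `U ∖ Z` extends to
`X`. -/
theorem surjective_sectionsPullback_of_isHartogs (Z : Closeds Y)
    (hZ : IsAnalyticSubset E (Z : Set Y)) (hZc : _root_.IsConnected (Z : Set Y))
    (hZne : (Z : Set Y) ≠ Set.univ) {X : Opens Y} (hX : X = Z.compl)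
    (F : TopCat.Sheaf (ModuleCat ℂ) (TopCat.of Y))
    (e : inverseImage (inclusionMap X) F ≅ holomorphicSheaf E X) (hH : IsHartogs E X) :
    Function.Surjective (sectionsPullback (inclusionMap Z) F) := by
  intro b
  obtain ⟨V, hV, a₀, ha₀⟩ := exists_section_near_closed Z F b
  -- The connected neighbourhood of `Z` is a connected component of `V`.
  have : LocallyConnectedSpace Y :=
    have : LocallyConnectedSpace E := inferInstance
    ChartedSpace.locallyConnectedSpace E Y
  obtain ⟨z₀, hz₀⟩ := hZc.nonempty
  let U : Opens Y := ⟨connectedComponentIn V z₀, V.isOpen.connectedComponentIn⟩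
  have hUV : U ≤ V := connectedComponentIn_subset _ _
  have hZU : (Z : Set Y) ⊆ U := hZc.isPreconnected.subset_connectedComponentIn hz₀ hV
  have hUc : _root_.IsConnected (U : Set Y) := isConnected_connectedComponentIn_iff.2 (hV hz₀)
  have hdiff := isConnected_diff_of_isAnalyticSubset hZ hZne U.isOpen hUc
  let UX : Opens X := (Opens.map (inclusionMap X)).obj U
  have himage : Subtype.val '' (UX : Set X) = (U : Set Y) \ Z := by
    ext y
    constructor
    · rintro ⟨x, hx, rfl⟩
      exact ⟨hx, fun h => hX.le x.2 h⟩
    · rintro ⟨hy, hyZ⟩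
      exact ⟨⟨y, hX.ge hyZ⟩, hy, rfl⟩
  have hUXc : _root_.IsConnected (UX : Set X) := by
    rw [← himage] at hdiff
    exact ⟨hdiff.nonempty.of_image,
      Topology.IsInducing.subtypeVal.isPreconnected_image.1 hdiff.isPreconnected⟩
  have hUXk : IsCompact ((UX : Set X)ᶜ) := by
    rw [Subtype.isCompact_iff]
    have : Subtype.val '' ((UX : Set X)ᶜ) = (U : Set Y)ᶜ := by
      ext y
      constructor
      · rintro ⟨x, hx, rfl⟩; exact hx
      · exact fun hy => ⟨⟨y, hX.ge fun hyZ => hy (hZU hyZ)⟩, hy, rfl⟩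
    rw [this]
    exact U.isOpen.isClosed_compl.isCompact
  let a := res F.presheaf hUV a₀
  obtain ⟨c', hc'⟩ := (hH UX hUXk hUXc).2 (onSections e.hom.hom UX (unitOn (inclusionMap X) F U a))
  have he {W : Opens X} (s : (inverseImage (inclusionMap X) F).presheaf.obj (op W)) :
      onSections e.inv.hom W (onSections e.hom.hom W s) = s :=
    congrArg (fun ψ => (ψ.hom.app (op W)).hom s) e.hom_inv_id
  obtain ⟨s, hs⟩ := exists_global_section_of_extension Z F hX hZU a (onSections e.inv.hom ⊤ c') (by
    refine (onSections_res e.inv.hom le_top c').symm.trans ?_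
    exact (congrArg (onSections e.inv.hom UX) hc').trans (he _))
  refine ⟨s, ?_⟩
  change unitOn (inclusionMap Z) F ⊤ s = b
  have h1 : unitOn (inclusionMap Z) F U a =
      res (inverseImage (inclusionMap Z) F).presheaf le_top b := by
    rw [unitOn_res, ha₀]
    exact res_res _ _ _ _
  rw [← hs, unitOn_res] at h1
  have h2 := congrArg (res (inverseImage (inclusionMap Z) F).presheaf
    (top_le_map_inclusionMap Z hZU)) h1
  exact (((res_res _ _ _ _).trans (res_self _ _ _)).symm.trans h2).trans
    ((res_res _ _ _ _).trans (res_self _ _ _))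

end Main

end HartogsLefschetz

end

theorem mainTheorem5
    {E : Type*} [NormedAddCommGroup E] [NormedSpace ℂ E] [FiniteDimensional ℂ E]
    {X' : Type} [TopologicalSpace X'] [T2Space X'] [CompactSpace X'] [ConnectedSpace X']
    [ChartedSpace E X'] [IsManifold 𝓘(ℂ, E) ω X']
    (Z : Closeds X') (hZ_analytic : HartogsLefschetz.IsAnalyticSubset E (Z : Set X'))
    (hZ_connected : _root_.IsConnected (Z : Set X')) (hZ_proper : (Z : Set X') ≠ Set.univ)
    (X : Opens X') (hX : X = Z.compl)
    (F : TopCat.Sheaf (ModuleCat ℂ) (TopCat.of X'))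
    (hF : Nonempty (HartogsLefschetz.inverseImage (HartogsLefschetz.inclusionMap X) F ≅
      HartogsLefschetz.holomorphicSheaf E X))
    (m : ℕ) (hm : Module.rank ℂ (HartogsLefschetz.cohomology 1 F) = m) :
    List.TFAE [
      HartogsLefschetz.IsHartogs E X,
      Function.Surjective
        (HartogsLefschetz.sectionsPullback (HartogsLefschetz.inclusionMap Z) F),
      Module.rank ℂ
        (HartogsLefschetz.compactCohomology 1 (HartogsLefschetz.holomorphicSheaf E X)) ≤ m] := by
  obtain ⟨e⟩ := hF
  tfae_have 1 → 2 := fun h => HartogsLefschetz.surjective_sectionsPullback_of_isHartogs Z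
    hZ_analytic hZ_connected hZ_proper hX F e h
  tfae_have 2 → 3 := fun h => by
    have h1 := HartogsLefschetz.rank_compactCohomology_le Z F hX h
    have h2 := (((HartogsLefschetz.compactSections (TopCat.of X)).rightDerived 1).mapIso
      e).toLinearEquiv.rank_eq
    rw [← hm]
    exact h2.symm.le.trans h1
  tfae_have 3 → 1 := fun h => by
    have hXset : (X : Set X') = (Set.univ : Set X') \ Z := by
      rw [hX]; exact Set.compl_eq_univ_sdiff _
    have hXc : _root_.IsConnected (X : Set X') := by
      rw [hXset]
      exact HartogsLefschetz.isConnected_diff_of_isAnalyticSubset hZ_analytic hZ_proper isOpen_univ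
        isConnected_univ
    have : ConnectedSpace X := isConnected_iff_connectedSpace.1 hXc
    -- A compact `X` would be open and closed in the connected space `X'`.
    have : NoncompactSpace X := by
      refine not_compactSpace_iff.1 fun hc => ?_
      have hclosed : IsClosed (X : Set X') := (isCompact_iff_compactSpace.2 hc).isClosed
      have huniv := IsClopen.eq_univ ⟨hclosed, X.isOpen⟩ hXc.nonempty
      obtain ⟨z, hz⟩ := hZ_connected.nonempty
      exact (hXset.symm ▸ huniv.symm ▸ Set.mem_univ z : z ∈ (Set.univ : Set X') \ Z).2 hz
    have : Module.Finite ℂ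
        (HartogsLefschetz.compactCohomology 1 (HartogsLefschetz.holomorphicSheaf E X)) :=
      Module.rank_lt_aleph0_iff.1 (h.trans_lt Cardinal.natCast_lt_aleph0)
    exact HartogsLefschetz.isHartogs_of_finite
  tfae_finish
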